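/- Let $(S_n)_{n\ge 0}$ be a simple random walk on $\mathbb{Z}$ with $S_0=0$, that is, the increments $S_{n+1}-S_n$ are independent and each equals $+1$ or $-1$ with probability $1/2$. For $n\in\mathbb{N}$ and $s\in\mathbb{Z}$ let $\xi(s,n)=\#\{0\le j\le n : S_j=s\}$, and let $g_1(n)=\#\{s\in\mathbb{Z} : \xi(s,n)=1\}$ be the number of sites visited exactly once up to time $n$. Then, with probability $1$, $$\limsup_{n\to\infty}\frac{g_1(n)}{\log^2 n}=\frac{1}{16},$$ where $\log$ is the natural logarithm and $\log^2 n=(\log n)^2$. -/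

import Mathlib

open MeasureTheory ProbabilityTheory Filter

/-- `S` is a simple random walk on `ℤ` started at `0`, defined on the probability space `(Ω, μ)`:
`S 0 = 0` almost surely, and the increments `S (n + 1) - S n` are independent and each takes the
values `1` and `-1` with probability `1 / 2`. -/
structure IsSimpleRandomWalk {Ω : Type*} [MeasurableSpace Ω] (μ : Measure Ω)
    (S : ℕ → Ω → ℤ) : Prop where
  measurable : ∀ n, Measurable (S n)
  start : ∀ᵐ ω ∂μ, S 0 ω = 0
  indep : iIndepFun (fun (n : ℕ) (ω : Ω) => S (n + 1) ω - S n ω) μ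
  step_up : ∀ n, μ {ω | S (n + 1) ω - S n ω = 1} = 1 / 2
  step_down : ∀ n, μ {ω | S (n + 1) ω - S n ω = -1} = 1 / 2

/-- The local time `ξ(s, n) = #{0 ≤ j ≤ n : x j = s}` of the path `x` at the site `s`. -/
def localTime (x : ℕ → ℤ) (s : ℤ) (n : ℕ) : ℕ :=
  ((Finset.range (n + 1)).filter (fun j => x j = s)).card

/-- The set of sites that the path `x` visits exactly once up to time `n`. -/
def onceVisited (x : ℕ → ℤ) (n : ℕ) : Set ℤ :=
  {s | localTime x s n = 1}

/-- The set of sites visited exactly once is finite, so that its `Set.ncard` is its cardinality. -/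
theorem finite_onceVisited (x : ℕ → ℤ) (n : ℕ) : (onceVisited x n).Finite := by
  refine ((Finset.range (n + 1)).image x).finite_toSet.subset fun s hs => ?_
  have h : 0 < localTime x s n := by
    have h1 : localTime x s n = 1 := hs
    omega
  obtain ⟨j, hj⟩ := Finset.card_pos.mp h
  rw [Finset.mem_filter] at hj
  exact Finset.mem_coe.mpr (Finset.mem_image.mpr ⟨j, hj.1, hj.2⟩)

/-- `g₁(n)`: the number of sites that the path `x` visits exactly once up to time `n`. -/
noncomputable def numOnceVisited (x : ℕ → ℤ) (n : ℕ) : ℕ :=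
  (onceVisited x n).ncard

/-! Cut the path at its first passages to the levels 0, 1, 2, … and let `d t` be the depth to which
the walk falls below `t` between reaching `t` and reaching `t + 1`. The depths are independent with
P(d t < c) = c / (c + 1) (`map_depthSeq`, `isDepthLaw_depthLaw`). Whether a site s has been visited
once when the level m is reached is read off the depths (`IsCut`), and the probability telescopes to
1 / (2 (m - s)). Let N_m be the number of such sites in [0, m) (`cutCount`). While the walk is
nonnegative, g₁ exceeds N_m by at most 2, m being the highest level reached; reflection covers the
other times. The level m is reached at time m^(2 + o(1)), so log n ~ 2 log m, and the claim becomes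
limsup N_m / log² m = 1/4.

There is a renewal structure: if s is a cut for m, then a lower site is a cut for m if and only if
it is one for s (`IsCut.isCut_iff`). Hence N_m resembles a geometric variable with mean about (log
m) / 2, and P(N_m ≥ v) is roughly exp(-2 v / log m). A union bound over m ≤ L would only give the
constant 1/2, because neighbouring levels share their distant cuts. The right count is multiscale: v
cuts at distance about e^u cost exp(-2 v / u), and refining the scale by du offers e^(du)
independent choices. The gain is therefore u du / 2, and integrating up to log L gives (log L)² / 4.

For the upper bound, the maximum of N up to B^i is estimated by an exponential moment with parameter
proportional to 1 / i. Each passage to the next scale costs one factor B, and Jensen's inequality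
lowers the parameter (`IsDepthLaw.lintegral_exp_maxCutCount_pow_le`). For the lower bound, each
scale offers many independent blocks, in one of which a run of cuts is likely to be followed by a
protected stretch that is already good at the smaller scale (`IsDepthLaw.half_le_measureReal_step`).
Borel–Cantelli and independence over disjoint stretches make both bounds almost sure. -/

/-! ### Independent sequences split at a fixed index -/

/-- The law of a sequence of independent random variables with common law `ν`. -/
noncomputable abbrev iidMeasure {α : Type*} [MeasurableSpace α] (ν : Measure α) : Measure (ℕ → α) :=
  Measure.infinitePi (fun _ : ℕ => ν)

/-- The sequence `x` without its first `n` terms. -/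
def seqShift {α : Type*} (n : ℕ) (x : ℕ → α) : ℕ → α := fun i => x (n + i)

/-- The first `n` terms of `x`, followed by `y`. -/
def seqConcat {α : Type*} (n : ℕ) (x y : ℕ → α) : ℕ → α := fun i => if i < n then x i else y (i - n)

theorem seqShift_seqShift {α : Type*} (m n : ℕ) (x : ℕ → α) :
    seqShift m (seqShift n x) = seqShift (n + m) x := by
  funext i
  simp [seqShift, add_assoc]

theorem measurable_seqShift {α : Type*} [MeasurableSpace α] (n : ℕ) : Measurable (seqShift n : (ℕ → α) → ℕ → α) :=
  measurable_pi_lambda _ fun _ => measurable_pi_apply _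

theorem seqShift_seqConcat {α : Type*} (n : ℕ) (x y : ℕ → α) : seqShift n (seqConcat n x y) = y := by
  funext i
  simp [seqShift, seqConcat]

theorem measurable_seqConcat {α : Type*} [MeasurableSpace α] (n : ℕ) :
    Measurable (fun p : (ℕ → α) × (ℕ → α) => seqConcat n p.1 p.2) := by
  refine measurable_pi_lambda _ fun i => ?_
  by_cases h : i < n
  · simp only [seqConcat, h, if_true]
    exact (measurable_pi_apply i).comp measurable_fst
  · simp only [seqConcat, h, if_false]
    exact (measurable_pi_apply (i - n)).comp measurable_snd

section ProductMeasure

variable {α : Type*} [MeasurableSpace α] (ν : Measure α) [IsProbabilityMeasure ν]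

/-- A product measure is determined by its values on finite boxes, and a box pulls back to the
product of its part below `n` and its shifted part from `n` on. -/
theorem map_seqConcat (n : ℕ) :
    ((iidMeasure ν).prod (iidMeasure ν)).map (fun p => seqConcat n p.1 p.2) = iidMeasure ν := by
  refine Measure.eq_infinitePi _ fun s t ht => ?_
  rw [Measure.map_apply (measurable_seqConcat n)
    (MeasurableSet.pi s.countable_toSet fun i _ => ht i)]
  have h : (fun p : (ℕ → α) × (ℕ → α) => seqConcat n p.1 p.2) ⁻¹' (Set.pi s t) =
      (Set.pi ((s.filter (· < n) : Finset ℕ) : Set ℕ) t) ×ˢ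
      (Set.pi (((s.filter (¬ · < n)).image (· - n) : Finset ℕ) : Set ℕ)
        (fun i => t (n + i))) := by
    ext ⟨x, y⟩
    simp only [Set.mem_preimage, Set.mem_pi, Set.mem_prod, Finset.mem_coe, Finset.mem_filter,
      Finset.mem_image, seqConcat]
    constructor
    · intro h
      refine ⟨fun i hi => by simpa [hi.2] using h i hi.1, ?_⟩
      rintro _ ⟨i, hi, rfl⟩
      have := h i hi.1
      rw [if_neg hi.2] at this
      rwa [Nat.add_sub_cancel' (not_lt.mp hi.2)]
    · rintro ⟨h1, h2⟩ i hi
      split_ifs with hin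
      · exact h1 i ⟨hi, hin⟩
      · have := h2 (i - n) ⟨i, ⟨hi, hin⟩, rfl⟩
        rwa [Nat.add_sub_cancel' (not_lt.mp hin)] at this
  rw [h, Measure.prod_prod, Measure.infinitePi_pi _ (fun i _ => ht i),
    Measure.infinitePi_pi _ (fun i _ => ht _), Finset.prod_image, ← Finset.prod_filter_mul_prod_filter_not s (· < n)]
  · congr 1
    refine Finset.prod_congr rfl fun i hi => ?_
    rw [Nat.add_sub_cancel' (not_lt.mp (Finset.mem_filter.mp hi).2)]
  · intro i hi j hj hij
    simp only [Finset.coe_filter, Set.mem_ofPred_eq] at hi hj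
    simp only at hij
    omega

/-- After resampling by `map_seqConcat`, the first factor sees only one of two independent copies
and the second factor only the other. This is the Markov property at a fixed index. -/
theorem lintegral_mul_comp_seqShift {n : ℕ} {f h : (ℕ → α) → ENNReal} (hf : Measurable f)
    (hfn : DependsOn f (Set.Iio n)) (hh : Measurable h) :
    ∫⁻ x, f x * h (seqShift n x) ∂iidMeasure ν =
      (∫⁻ x, f x ∂iidMeasure ν) * ∫⁻ x, h x ∂iidMeasure ν := by
  conv_lhs => rw [← map_seqConcat ν n]
  rw [lintegral_map (f := fun x => f x * h (seqShift n x))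
    (hf.mul (hh.comp (measurable_seqShift n))) (measurable_seqConcat n),
    ← lintegral_prod_mul hf.aemeasurable hh.aemeasurable]
  refine lintegral_congr fun p => ?_
  rw [seqShift_seqConcat]
  congr 1
  exact hfn fun i hi => by simp [seqConcat, Set.mem_Iio.mp hi]

theorem measure_inter_preimage_seqShift {n : ℕ} {A B : Set (ℕ → α)} (hA : MeasurableSet A)
    (hAn : DependsOn (· ∈ A) (Set.Iio n)) (hB : MeasurableSet B) :
    iidMeasure ν (A ∩ seqShift n ⁻¹' B) = iidMeasure ν A * iidMeasure ν B := by
  have h := lintegral_mul_comp_seqShift ν (n := n) (f := A.indicator 1) (h := B.indicator 1)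
    (measurable_one.indicator hA) (fun x y hxy => by
      have h : (x ∈ A) = (y ∈ A) := hAn hxy
      by_cases hx : x ∈ A
      · simp [hx, h ▸ hx]
      · simp [hx, h ▸ hx]) (measurable_one.indicator hB)
  rw [lintegral_indicator_one hA, lintegral_indicator_one hB] at h
  rw [← h, ← lintegral_indicator_one (hA.inter (measurable_seqShift n hB))]
  refine lintegral_congr fun x => ?_
  rw [Set.inter_indicator_one]
  rfl

theorem measureReal_inter_preimage_seqShift {n : ℕ} {A B : Set (ℕ → α)} (hA : MeasurableSet A)
    (hAn : DependsOn (· ∈ A) (Set.Iio n)) (hB : MeasurableSet B) :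
    (iidMeasure ν).real (A ∩ seqShift n ⁻¹' B) =
      (iidMeasure ν).real A * (iidMeasure ν).real B := by
  simp only [Measure.real, measure_inter_preimage_seqShift ν hA hAn hB, ENNReal.toReal_mul]

end ProductMeasure

/-- Such a function factors through finitely many coordinates, hence through a countable discrete
space, where every function is measurable. -/
theorem measurable_of_dependsOn {α : Type*} [Countable α] [MeasurableSpace α]
    [MeasurableSingletonClass α] {β : Type*} [MeasurableSpace β] {f : (ℕ → α) → β} {n : ℕ}
    (hf : DependsOn f (Set.Iio n)) : Measurable f := by
  rcases isEmpty_or_nonempty α with hα | ⟨⟨a⟩⟩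
  · exact measurable_of_empty f
  let F : (Fin n → α) → β := fun y => f fun i => if h : i < n then y ⟨i, h⟩ else a
  let r : (ℕ → α) → Fin n → α := fun x i => x i
  have h : f = F ∘ r := by
    funext x
    exact hf fun i hi => by simp [r, Set.mem_Iio.mp hi]
  have hr : Measurable r := measurable_pi_lambda _ fun i => measurable_pi_apply _
  rw [h]
  exact (measurable_of_countable F).comp hr

/-! ### Cut sites of a sequence of depths -/

/-- If `d t` is the depth of the excursions of a walk below the level `t` before it reaches
`t + 1`, then the site `s` is visited exactly once before the level `m` is reached. -/
def IsCut (d : ℕ → ℕ) (s m : ℕ) : Prop := ∀ i, s + i < m → d (s + i) < max i 1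

open Classical in
/-- The number of sites of `[a, m)` visited exactly once before the level `m` is reached. -/
noncomputable def cutCount (d : ℕ → ℕ) (a m : ℕ) : ℕ :=
  ((Finset.Ico a m).filter (fun s => IsCut d s m)).card

theorem isCut_seqShift (d : ℕ → ℕ) (a s m : ℕ) :
    IsCut (seqShift a d) s m ↔ IsCut d (a + s) (a + m) := by
  simp only [IsCut, seqShift]
  refine forall_congr' fun i => ?_
  rw [add_assoc]
  simp

theorem IsCut.mono {d : ℕ → ℕ} {s m n : ℕ} (h : IsCut d s n) (hmn : m ≤ n) : IsCut d s m :=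
  fun i hi => h i (hi.trans_le hmn)

/-- The renewal property. From `s` on, being a cut at `s` is the stricter requirement, since the
permitted depth at a level grows with the distance from the site; so only the levels below `s`
matter for `t`. -/
theorem IsCut.isCut_iff {d : ℕ → ℕ} {s t m : ℕ} (h : IsCut d s m) (hts : t ≤ s) (hsm : s ≤ m) :
    IsCut d t m ↔ IsCut d t s := by
  refine ⟨fun ht => ht.mono hsm, fun ht i hi => ?_⟩
  rcases lt_or_ge (t + i) s with his | his
  · exact ht i his
  · obtain ⟨j, hj⟩ := Nat.exists_eq_add_of_le his
    have := h j (hj ▸ hi)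
    rw [hj]
    omega

theorem dependsOn_isCut (s m : ℕ) : DependsOn (fun d => IsCut d s m) (Set.Iio m) := by
  intro d e h
  simp only [IsCut, eq_iff_iff]
  refine forall_congr' fun i => imp_congr_right fun hi => ?_
  rw [h _ (Set.mem_Iio.mpr hi)]

theorem dependsOn_cutCount (a m : ℕ) : DependsOn (fun d => cutCount d a m) (Set.Iio m) := by
  intro d e h
  classical
  simp only [cutCount]
  refine congrArg Finset.card (Finset.filter_congr fun s _ => ?_)
  have : IsCut d s m = IsCut e s m := dependsOn_isCut s m h
  rw [this]

theorem measurableSet_isCut (s m : ℕ) : MeasurableSet {d | IsCut d s m} :=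
  measurableSet_setOfPred.mpr (measurable_of_dependsOn (dependsOn_isCut s m))

theorem measurable_cutCount (a m : ℕ) : Measurable (fun d => cutCount d a m) :=
  measurable_of_dependsOn (dependsOn_cutCount a m)

theorem cutCount_seqShift (d : ℕ → ℕ) (a s m : ℕ) :
    cutCount (seqShift a d) s m = cutCount d (a + s) (a + m) := by
  classical
  simp only [cutCount, isCut_seqShift]
  rw [← Finset.card_image_of_injective _ (add_right_injective a)]
  congr 1
  ext t
  simp only [Finset.mem_image, Finset.mem_filter, Finset.mem_Ico]
  constructor
  · rintro ⟨u, ⟨h1, h2⟩, rfl⟩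
    exact ⟨by omega, h2⟩
  · rintro ⟨h1, h2⟩
    refine ⟨t - a, ⟨by omega, ?_⟩, by omega⟩
    rwa [Nat.add_sub_cancel' (by omega)]

theorem cutCount_anti_left (d : ℕ → ℕ) {a b : ℕ} (m : ℕ) (h : a ≤ b) :
    cutCount d b m ≤ cutCount d a m := by
  classical
  exact Finset.card_le_card (Finset.filter_subset_filter _ (Finset.Ico_subset_Ico_left h))

theorem cutCount_le_add (d : ℕ → ℕ) {a b m : ℕ} (hab : a ≤ b) (hbm : b ≤ m) :
    cutCount d a m ≤ cutCount d a b + cutCount d b m := by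
  classical
  unfold cutCount
  rw [← Finset.Ico_union_Ico_eq_Ico hab hbm, Finset.filter_union]
  refine (Finset.card_union_le _ _).trans (Nat.add_le_add_right (Finset.card_le_card ?_) _)
  exact Finset.monotone_filter_right _ fun s _ hs => hs.mono hbm

/-- The probability that `0` is visited exactly once before the level `g` is reached. -/
noncomputable def cutProb (g : ℕ) : ℝ := if g = 0 then 1 else 1 / (2 * g)

theorem cutProb_nonneg (g : ℕ) : 0 ≤ cutProb g := by
  unfold cutProb
  split_ifs <;> positivity

theorem sum_cutProb (n : ℕ) :
    ∑ j ∈ Finset.range (n + 1), cutProb j = 1 + (harmonic n : ℝ) / 2 := by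
  induction n with
  | zero => simp [cutProb]
  | succ n ih =>
    rw [Finset.sum_range_succ, ih, harmonic_succ, cutProb, if_neg (by omega)]
    push_cast
    field_simp
    ring

/-- The law of the depth of the excursions below a level before the next level is reached. -/
def IsDepthLaw (ρ : Measure ℕ) : Prop := ∀ c : ℕ, ρ.real (Set.Iio c) = c / (c + 1)

/-! ### The renewal equation and the exponential moments at a fixed level -/

section Depth

variable {ρ : Measure ℕ} [IsProbabilityMeasure ρ]

/-- The conditions at different levels are independent. The factor at distance 0 is 1/2, and the
factors i / (i + 1) for 1 ≤ i < g telescope to 1 / g. -/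
theorem IsDepthLaw.measureReal_isCut (hρ : IsDepthLaw ρ) (g : ℕ) :
    (iidMeasure ρ).real {d | IsCut d 0 g} = cutProb g := by
  have h : {d : ℕ → ℕ | IsCut d 0 g} =
      Set.pi (Finset.range g : Set ℕ) (fun i => Set.Iio (max i 1)) := by
    ext d
    simp [IsCut, Set.mem_pi]
  rw [h, Measure.real, Measure.infinitePi_pi _ (fun _ _ => measurableSet_Iio), ENNReal.toReal_prod]
  change ∏ i ∈ Finset.range g, ρ.real (Set.Iio (max i 1)) = _
  simp only [hρ _]
  rcases g with _ | g
  · simp [cutProb]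
  · rw [cutProb, if_neg (by omega)]
    induction g with
    | zero => norm_num
    | succ g ih =>
      rw [Finset.prod_range_succ, ih, max_eq_left (by omega)]
      · push_cast
        field_simp
      · ext d
        simp [IsCut, Set.mem_pi]

theorem IsDepthLaw.measure_isCut (hρ : IsDepthLaw ρ) (g : ℕ) :
    iidMeasure ρ {d | IsCut d 0 g} = ENNReal.ofReal (cutProb g) := by
  rw [← hρ.measureReal_isCut, ofReal_measureReal]

-- Each element `s` of the set raises the power by x times the power accumulated below `s`; the
-- identity sums these increments.
open Classical in
theorem one_add_pow_card_filter (x : ENNReal) (p : ℕ → Prop) (m : ℕ) :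
    (1 + x) ^ ((Finset.range m).filter p).card =
      1 + ∑ s ∈ Finset.range m,
        if p s then x * (1 + x) ^ ((Finset.range s).filter p).card else 0 := by
  induction m with
  | zero => simp
  | succ m ih =>
    rw [Finset.sum_range_succ, ← add_assoc, ← ih, Finset.range_add_one, Finset.filter_insert]
    split_ifs with h
    · rw [Finset.card_insert_of_notMem (by simp), pow_succ]
      ring
    · simp

-- By the renewal property the summand for `s` is a function of the depths below `s` times a
-- function of the depths from `s` on. Independence then turns expectations into a convolution.
open Classical in
theorem one_add_pow_cutCount (x : ENNReal) (d : ℕ → ℕ) (m : ℕ) :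
    (1 + x) ^ cutCount d 0 m = 1 + ∑ s ∈ Finset.range m,
      x * ((1 + x) ^ cutCount d 0 s * {e | IsCut e 0 (m - s)}.indicator 1 (seqShift s d)) := by
  simp only [cutCount, Nat.Ico_zero_eq_range]
  rw [one_add_pow_card_filter]
  congr 1
  refine Finset.sum_congr rfl fun s hs => ?_
  have hsm := (Finset.mem_range.mp hs).le
  simp only [Set.indicator_apply, Set.mem_ofPred_eq, isCut_seqShift, add_zero,
    Nat.add_sub_cancel' hsm]
  split_ifs with h
  · simp only [Pi.one_apply, mul_one]
    congr 3
    exact Finset.filter_congr fun t ht => h.isCut_iff (Finset.mem_range.mp ht).le hsm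
  · simp

theorem IsDepthLaw.lintegral_one_add_pow_cutCount (hρ : IsDepthLaw ρ) (x : ENNReal) (m : ℕ) :
    ∫⁻ d, (1 + x) ^ cutCount d 0 m ∂iidMeasure ρ = 1 + x * ∑ s ∈ Finset.range m,
      (∫⁻ d, (1 + x) ^ cutCount d 0 s ∂iidMeasure ρ) * ENNReal.ofReal (cutProb (m - s)) := by
  have hm : ∀ s, Measurable fun d => (1 + x) ^ cutCount d 0 s := fun s =>
    (measurable_of_countable fun n : ℕ => (1 + x) ^ n).comp (measurable_cutCount 0 s)
  have hi : ∀ g, Measurable ({e | IsCut e 0 g}.indicator (1 : (ℕ → ℕ) → ENNReal)) := fun g =>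
    measurable_one.indicator (measurableSet_isCut 0 g)
  have hp : ∀ s, Measurable fun d : ℕ → ℕ =>
      (1 + x) ^ cutCount d 0 s * {e | IsCut e 0 (m - s)}.indicator 1 (seqShift s d) := fun s =>
    (hm s).mul ((hi _).comp (measurable_seqShift s))
  simp_rw [one_add_pow_cutCount x _ m]
  rw [lintegral_add_left measurable_const, lintegral_finsetSum _ fun s _ => (hp s).const_mul x,
    lintegral_one, measure_univ, Finset.mul_sum]
  congr 1
  refine Finset.sum_congr rfl fun s _ => ?_
  rw [lintegral_const_mul _ (hp s),
    lintegral_mul_comp_seqShift ρ (f := fun d => (1 + x) ^ cutCount d 0 s) (hm s) _ (hi _),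
    lintegral_indicator_one (measurableSet_isCut 0 _), hρ.measure_isCut]
  intro d e h
  have : cutCount d 0 s = cutCount e 0 s := dependsOn_cutCount 0 s h
  simp only [this]

/-- Induction in the renewal equation: if all earlier moments are at most 1 / δ, the next is at most
1 + (1 - δ) / δ = 1 / δ. The condition on `x` says that x times the expected number of cuts stays
below 1, the radius of convergence of the geometric series. -/
theorem IsDepthLaw.lintegral_one_add_pow_cutCount_le (hρ : IsDepthLaw ρ) {x δ : ℝ} {L : ℕ}
    (hx : 0 ≤ x) (hδ : 0 < δ) (h : x * ((harmonic L : ℝ) / 2) ≤ 1 - δ) {m : ℕ} (hm : m ≤ L) :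
    ∫⁻ d, (1 + ENNReal.ofReal x) ^ cutCount d 0 m ∂iidMeasure ρ ≤ ENNReal.ofReal (1 / δ) := by
  induction m using Nat.strong_induction_on with
  | _ m ih =>
  rw [hρ.lintegral_one_add_pow_cutCount]
  have h1 : ∑ s ∈ Finset.range m, (∫⁻ d, (1 + ENNReal.ofReal x) ^ cutCount d 0 s ∂iidMeasure ρ) *
      ENNReal.ofReal (cutProb (m - s)) ≤ ENNReal.ofReal (1 / δ * ((harmonic L : ℝ) / 2)) := by
    calc _ ≤ ∑ s ∈ Finset.range m, ENNReal.ofReal (1 / δ) * ENNReal.ofReal (cutProb (m - s)) := by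
          refine Finset.sum_le_sum fun s hs => ?_
          gcongr
          exact ih s (Finset.mem_range.mp hs) ((Finset.mem_range.mp hs).le.trans hm)
      _ = ENNReal.ofReal (1 / δ * ∑ s ∈ Finset.range m, cutProb (m - s)) := by
          rw [← Finset.mul_sum, ← ENNReal.ofReal_sum_of_nonneg fun _ _ => cutProb_nonneg _,
            ENNReal.ofReal_mul (by positivity)]
      _ ≤ _ := by
          gcongr
          have h2 : ∑ s ∈ Finset.range m, cutProb (m - s) =
              ∑ s ∈ Finset.range m, cutProb (s + 1) := by
            rw [← Finset.sum_range_reflect]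
            refine Finset.sum_congr rfl fun s hs => ?_
            have := Finset.mem_range.mp hs
            congr 1
            omega
          have h3 := sum_cutProb L
          rw [Finset.sum_range_succ'] at h3
          have h4 : ∑ s ∈ Finset.range m, cutProb (s + 1) ≤ ∑ s ∈ Finset.range L, cutProb (s + 1) :=
            Finset.sum_le_sum_of_subset_of_nonneg (Finset.range_mono hm)
              fun _ _ _ => cutProb_nonneg _
          have h5 : cutProb 0 = 1 := by simp [cutProb]
          rw [h2]
          linarith
  calc _ ≤ 1 + ENNReal.ofReal x * ENNReal.ofReal (1 / δ * ((harmonic L : ℝ) / 2)) := by gcongr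
    _ = ENNReal.ofReal (1 + x * (1 / δ * ((harmonic L : ℝ) / 2))) := by
      have h0 : (0 : ℝ) ≤ harmonic L := by
        rw [harmonic]; push_cast; positivity
      rw [ENNReal.ofReal_add zero_le_one (by positivity), ENNReal.ofReal_one,
        ENNReal.ofReal_mul hx]
    _ ≤ _ := by
      gcongr
      calc 1 + x * (1 / δ * ((harmonic L : ℝ) / 2))
          = 1 + 1 / δ * (x * ((harmonic L : ℝ) / 2)) := by ring
        _ ≤ 1 + 1 / δ * (1 - δ) := by gcongr
        _ = 1 / δ := by field_simp; ring

end Depth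

/-! ### The upper bound: exponential moments of the maximum over many scales -/

/-- The largest number of sites visited exactly once before some level below `L` is reached. -/
noncomputable def maxCutCount (d : ℕ → ℕ) (L : ℕ) : ℕ := (Finset.range L).sup (cutCount d 0)

theorem cutCount_le_maxCutCount (d : ℕ → ℕ) {m L : ℕ} (h : m < L) :
    cutCount d 0 m ≤ maxCutCount d L :=
  Finset.le_sup (f := cutCount d 0) (Finset.mem_range.mpr h)

theorem dependsOn_maxCutCount (L : ℕ) : DependsOn (fun d => maxCutCount d L) (Set.Iio L) := by
  intro d e h
  refine Finset.sup_congr rfl fun m hm => ?_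
  exact dependsOn_cutCount 0 m fun i hi =>
    h i (Set.mem_Iio.mpr ((Set.mem_Iio.mp hi).trans (Finset.mem_range.mp hm)))

theorem measurable_maxCutCount (L : ℕ) : Measurable (fun d => maxCutCount d L) :=
  measurable_of_dependsOn (dependsOn_maxCutCount L)

/-- Round the maximising level down to a multiple of `L`. Cuts below that multiple were already cuts
there, and the others belong to a shifted window of length `L`. -/
theorem exists_maxCutCount_mul_le (d : ℕ → ℕ) {B L : ℕ} (hB : 0 < B) (hL : 0 < L) :
    ∃ j < B, maxCutCount d (B * L) ≤
      cutCount d 0 (j * L) + maxCutCount (seqShift (j * L) d) L := by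
  obtain ⟨m, hm, h⟩ := Finset.exists_mem_eq_sup (Finset.range (B * L))
    (Finset.nonempty_range_iff.mpr (by positivity)) (cutCount d 0)
  have hjm : m / L * L ≤ m := Nat.div_mul_le_self m L
  refine ⟨m / L, (Nat.div_lt_iff_lt_mul hL).mpr (Finset.mem_range.mp hm), ?_⟩
  rw [maxCutCount, h]
  refine (cutCount_le_add d (Nat.zero_le _) hjm).trans (Nat.add_le_add_left ?_ _)
  have h1 := cutCount_seqShift d (m / L * L) 0 (m - m / L * L)
  rw [add_zero, Nat.add_sub_cancel' hjm] at h1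
  rw [← h1]
  refine cutCount_le_maxCutCount _ ?_
  have := Nat.div_add_mod' m L
  have := Nat.mod_lt m hL
  omega

theorem lintegral_rpow_le_rpow_lintegral {Ω : Type*} [MeasurableSpace Ω] (μ : Measure Ω)
    [IsProbabilityMeasure μ] {f : Ω → ENNReal} (hf : Measurable f) {p : ℝ} (hp : 0 ≤ p)
    (hp1 : p ≤ 1) : ∫⁻ x, f x ^ p ∂μ ≤ (∫⁻ x, f x ∂μ) ^ p := by
  have := ENNReal.lintegral_mul_norm_pow_le (μ := μ) hf.aemeasurable
    (aemeasurable_const (b := (1 : ENNReal))) hp (sub_nonneg.mpr hp1) (by ring)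
  simpa using this

section Depth

variable {ρ : Measure ℕ} [IsProbabilityMeasure ρ]

theorem measurable_exp_mul (c : ℝ) : Measurable fun n : ℕ => ENNReal.ofReal (Real.exp (c * n)) :=
  measurable_of_countable _

theorem lintegral_exp_maxCutCount_mul_le {c : ℝ} (hc : 0 ≤ c) {B L : ℕ} (hB : 0 < B) (hL : 0 < L)
    {C : ENNReal}
    (hC : ∀ m ≤ B * L, ∫⁻ d, ENNReal.ofReal (Real.exp (c * cutCount d 0 m)) ∂iidMeasure ρ ≤ C) :
    ∫⁻ d, ENNReal.ofReal (Real.exp (c * maxCutCount d (B * L))) ∂iidMeasure ρ ≤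
      B * C * ∫⁻ d, ENNReal.ofReal (Real.exp (c * maxCutCount d L)) ∂iidMeasure ρ := by
  set E : ℕ → ENNReal := fun n => ENNReal.ofReal (Real.exp (c * n)) with hE
  have hEm : Measurable E := measurable_exp_mul c
  have hadd : ∀ m n, E (m + n) = E m * E n := fun m n => by
    rw [hE, ← ENNReal.ofReal_mul (Real.exp_pos _).le, ← Real.exp_add]
    push_cast
    ring_nf
  have hmono : Monotone E := fun m n h => by
    refine ENNReal.ofReal_le_ofReal (Real.exp_le_exp.mpr ?_)
    gcongr
  have hpt : ∀ d, E (maxCutCount d (B * L)) ≤ ∑ j ∈ Finset.range B,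
      E (cutCount d 0 (j * L)) * E (maxCutCount (seqShift (j * L) d) L) := fun d => by
    obtain ⟨j, hj, h⟩ := exists_maxCutCount_mul_le d hB hL
    refine (hmono h).trans ?_
    rw [hadd]
    exact Finset.single_le_sum
      (f := fun j => E (cutCount d 0 (j * L)) * E (maxCutCount (seqShift (j * L) d) L))
      (fun _ _ => zero_le) (Finset.mem_range.mpr hj)
  have hm1 : ∀ j, Measurable fun d => E (cutCount d 0 (j * L)) := fun j =>
    hEm.comp (measurable_cutCount 0 _)
  have hm2 : Measurable fun d => E (maxCutCount d L) := hEm.comp (measurable_maxCutCount L)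
  calc ∫⁻ d, E (maxCutCount d (B * L)) ∂iidMeasure ρ
      ≤ ∫⁻ d, ∑ j ∈ Finset.range B,
        E (cutCount d 0 (j * L)) * E (maxCutCount (seqShift (j * L) d) L) ∂iidMeasure ρ :=
        lintegral_mono hpt
    _ = ∑ j ∈ Finset.range B, (∫⁻ d, E (cutCount d 0 (j * L)) ∂iidMeasure ρ) *
        ∫⁻ d, E (maxCutCount d L) ∂iidMeasure ρ := by
        have hm3 : ∀ j, Measurable fun d =>
            E (cutCount d 0 (j * L)) * E (maxCutCount (seqShift (j * L) d) L) := fun j =>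
          (hm1 j).mul (hm2.comp (measurable_seqShift _))
        rw [lintegral_finsetSum _ fun j _ => hm3 j]
        refine Finset.sum_congr rfl fun j _ => ?_
        rw [lintegral_mul_comp_seqShift ρ (f := fun d => E (cutCount d 0 (j * L)))
          (h := fun d => E (maxCutCount d L)) (hm1 j) _ hm2]
        intro d e h
        have : cutCount d 0 (j * L) = cutCount e 0 (j * L) := dependsOn_cutCount 0 _ h
        simp only [this]
    _ ≤ ∑ j ∈ Finset.range B, C * ∫⁻ d, E (maxCutCount d L) ∂iidMeasure ρ := by
        refine Finset.sum_le_sum fun j hj => ?_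
        gcongr
        exact hC _ (Nat.mul_le_mul_right _ (Finset.mem_range.mp hj).le)
    _ = _ := by
        rw [Finset.sum_const, Finset.card_range, nsmul_eq_mul, mul_assoc]

/-- Passing from `B ^ i` to `B ^ (i + 1)` costs a factor B / δ: B possible blocks, and a fixed-level
moment at most 1 / δ. Jensen's inequality changes the parameter c / i into c / (i + 1) by raising to
the power i / (i + 1). The exponents satisfy a(i + 1) = 1 + a(i) i / (i + 1), solved by (i + 1) / 2;
this halving relative to a union bound is the source of 1/4 in place of 1/2. -/
theorem IsDepthLaw.lintegral_exp_maxCutCount_pow_le (hρ : IsDepthLaw ρ) {c δ : ℝ} (hc : 0 ≤ c)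
    (hδ : 0 < δ) (hδ1 : δ ≤ 1) {B : ℕ} (hB : 0 < B)
    (h : ∀ i : ℕ, (Real.exp (c / (i + 1)) - 1) * ((harmonic (B ^ (i + 1)) : ℝ) / 2) ≤ 1 - δ)
    (i : ℕ) :
    ∫⁻ d, ENNReal.ofReal (Real.exp (c / i * maxCutCount d (B ^ i))) ∂iidMeasure ρ ≤
      ENNReal.ofReal (B / δ) ^ (((i : ℝ) + 1) / 2) := by
  have hB1 : (1 : ℝ) ≤ B := by exact_mod_cast hB
  have hBδ : (1 : ENNReal) ≤ ENNReal.ofReal (B / δ) :=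
    ENNReal.one_le_ofReal.mpr ((one_le_div hδ).mpr (hδ1.trans hB1))
  induction i with
  -- Here `c / 0 = 0`, so the integrand is 1.
  | zero =>
    simp only [Nat.cast_zero, div_zero, zero_mul, Real.exp_zero, ENNReal.ofReal_one, lintegral_one,
      measure_univ]
    exact ENNReal.one_le_rpow hBδ (by norm_num)
  | succ i ih =>
    have hstep := lintegral_exp_maxCutCount_mul_le (ρ := ρ) (c := c / (i + 1)) (by positivity) hB
      (L := B ^ i) (by positivity) (C := ENNReal.ofReal (1 / δ)) (fun m hm => by
        have hx : 0 ≤ Real.exp (c / (i + 1)) - 1 :=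
          sub_nonneg.mpr (Real.one_le_exp (by positivity))
        have := hρ.lintegral_one_add_pow_cutCount_le hx hδ (h i) (m := m)
          (by rwa [pow_succ, mul_comm])
        refine le_of_eq_of_le (lintegral_congr fun d => ?_) this
        rw [← ENNReal.ofReal_one, ← ENNReal.ofReal_add zero_le_one hx, add_sub_cancel,
          ← ENNReal.ofReal_pow (Real.exp_pos _).le, ← Real.exp_nat_mul, mul_comm])
    have hconst : (B : ENNReal) * ENNReal.ofReal (1 / δ) = ENNReal.ofReal (B / δ) := by
      rw [← ENNReal.ofReal_natCast, ← ENNReal.ofReal_mul (by positivity), mul_one_div]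
    rw [hconst] at hstep
    have hjensen : ∫⁻ d, ENNReal.ofReal (Real.exp (c / (i + 1) * maxCutCount d (B ^ i)))
        ∂iidMeasure ρ ≤ ENNReal.ofReal (B / δ) ^ ((i : ℝ) / 2) := by
      -- The case `i = 0` is separate: Jensen's inequality gives nothing from the parameter `c / 0`,
      -- but no site lies below the only available level 0.
      rcases Nat.eq_zero_or_pos i with rfl | hi
      · have : ∀ d, maxCutCount d 1 = 0 := fun d => by
          simp [maxCutCount, cutCount]
        simp [this]
      · have hi' : (0 : ℝ) < i := by exact_mod_cast hi
        calc _ = ∫⁻ d, ENNReal.ofReal (Real.exp (c / i * maxCutCount d (B ^ i))) ^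
              ((i : ℝ) / (i + 1)) ∂iidMeasure ρ := by
              refine lintegral_congr fun d => ?_
              rw [ENNReal.ofReal_rpow_of_pos (Real.exp_pos _), ← Real.exp_mul]
              congr 2
              field_simp
          _ ≤ (∫⁻ d, ENNReal.ofReal (Real.exp (c / i * maxCutCount d (B ^ i))) ∂iidMeasure ρ) ^
              ((i : ℝ) / (i + 1)) :=
              lintegral_rpow_le_rpow_lintegral _
                ((measurable_exp_mul (c / i)).comp (measurable_maxCutCount _)) (by positivity)
                ((div_le_one (by positivity)).mpr (by linarith))
          _ ≤ (ENNReal.ofReal (B / δ) ^ (((i : ℝ) + 1) / 2)) ^ ((i : ℝ) / (i + 1)) := by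
              gcongr
          _ = _ := by
              rw [← ENNReal.rpow_mul]
              congr 1
              field_simp
    push_cast
    rw [pow_succ, mul_comm (B ^ i) B]
    refine hstep.trans ((mul_le_mul_right hjensen _).trans_eq ?_)
    rw [show ((i : ℝ) + 1 + 1) / 2 = 1 + (i : ℝ) / 2 by ring,
      ENNReal.rpow_add _ _ (zero_lt_one.trans_le hBδ).ne' ENNReal.ofReal_ne_top, ENNReal.rpow_one]

/-- To first order the left side is the product of 2 (1 - η) / ((i + 1) log B) and (i + 1) (log B) /
2, that is 1 - η. The lower bound on log B limits the two corrections, from the exponential and from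
the harmonic number, to factors 1 + η / 4 and 1 + η / 8. -/
theorem exp_sub_one_mul_harmonic_le {η : ℝ} (hη : 0 < η) (hη1 : η < 1) {B : ℕ}
    (hB : 8 / η ≤ Real.log B) (i : ℕ) :
    (Real.exp (2 * (1 - η) / Real.log B / (i + 1)) - 1) * ((harmonic (B ^ (i + 1)) : ℝ) / 2) ≤
      1 - η / 2 := by
  have hη8 : 8 ≤ 8 / η := by rw [le_div_iff₀ hη]; linarith
  have hl : 0 < Real.log B := by linarith
  set l := Real.log B with hldef
  set t := 2 * (1 - η) / l / (i + 1) with ht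
  have hi : (1 : ℝ) ≤ i + 1 := by linarith [(Nat.cast_nonneg i : (0 : ℝ) ≤ i)]
  have hη' : 0 < 1 - η := by linarith
  have ht0 : 0 ≤ t := by positivity
  have hl8 : 1 / l ≤ η / 8 := by
    rw [div_le_iff₀ hl]; rw [div_le_iff₀ hη] at hB; linarith
  have htl : t ≤ 2 / l := by
    rw [ht, div_le_iff₀ (by positivity), div_mul_eq_mul_div]
    gcongr
    nlinarith
  have ht4 : t ≤ η / 4 := htl.trans (by rw [← mul_one_div]; linarith)
  have hexp : Real.exp t - 1 ≤ t * (1 + t) := by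
    have := Real.abs_exp_sub_one_sub_id_le (x := t) (by rw [abs_of_nonneg ht0]; linarith)
    have := (abs_le.mp this).2
    nlinarith
  have hH : (harmonic (B ^ (i + 1)) : ℝ) ≤ 1 + (i + 1) * l := by
    have := harmonic_le_one_add_log (B ^ (i + 1))
    push_cast [Real.log_pow] at this
    exact this
  have hH0 : (0 : ℝ) ≤ harmonic (B ^ (i + 1)) := by
    rw [harmonic]; push_cast; positivity
  have h1 : t * ((1 + (i + 1) * l) / 2) ≤ (1 - η) * (1 + η / 8) := by
    have : t * ((1 + (i + 1) * l) / 2) = (1 - η) * (1 / l / (i + 1) + 1) := by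
      rw [ht]; field_simp
    rw [this]
    have h2 : 1 / l / (i + 1) ≤ η / 8 := (div_le_self (by positivity) hi).trans hl8
    exact mul_le_mul_of_nonneg_left (by linarith) hη'.le
  calc _ ≤ t * (1 + t) * ((1 + (i + 1) * l) / 2) := by gcongr
    _ = t * ((1 + (i + 1) * l) / 2) * (1 + t) := by ring
    _ ≤ (1 - η) * (1 + η / 8) * (1 + η / 4) := by gcongr
    _ ≤ 1 - η / 2 := by nlinarith [mul_pos hη hη', mul_pos hη hη]

theorem IsDepthLaw.measure_le_maxCutCount_le (hρ : IsDepthLaw ρ) {η v : ℝ} (hη : 0 < η)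
    (hη1 : η < 1) {B : ℕ} (hB : 8 / η ≤ Real.log B) (K : ℕ) :
    iidMeasure ρ {d | v ≤ maxCutCount d (B ^ K)} ≤ ENNReal.ofReal
      ((B / (η / 2)) ^ (((K : ℝ) + 1) / 2) *
        Real.exp (-(2 * (1 - η) / Real.log B / K * v))) := by
  have hB0 : 0 < B := by
    rcases Nat.eq_zero_or_pos B with rfl | h
    · rw [Nat.cast_zero, Real.log_zero] at hB
      exact absurd hB (not_le.mpr (by positivity))
    · exact h
  have hB1 : (0 : ℝ) < B := by exact_mod_cast hB0
  have hl : 0 < Real.log B := lt_of_lt_of_le (by positivity) hB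
  have hη' : 0 < 1 - η := by linarith
  set c := 2 * (1 - η) / Real.log B with hc
  have hc0 : 0 ≤ c := by positivity
  have hm := hρ.lintegral_exp_maxCutCount_pow_le hc0 (half_pos hη) (by linarith) hB0
    (exp_sub_one_mul_harmonic_le hη hη1 hB) K
  calc _ ≤ iidMeasure ρ {d | ENNReal.ofReal (Real.exp (c / K * v)) ≤
        ENNReal.ofReal (Real.exp (c / K * maxCutCount d (B ^ K)))} := by
        refine measure_mono fun d hd => ?_
        refine ENNReal.ofReal_le_ofReal (Real.exp_le_exp.mpr ?_)
        exact mul_le_mul_of_nonneg_left hd (by positivity)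
    _ ≤ (∫⁻ d, ENNReal.ofReal (Real.exp (c / K * maxCutCount d (B ^ K))) ∂iidMeasure ρ) /
        ENNReal.ofReal (Real.exp (c / K * v)) :=
        meas_ge_le_lintegral_div
          ((measurable_exp_mul (c / K)).comp (measurable_maxCutCount _)).aemeasurable
          (by simp [Real.exp_pos]) ENNReal.ofReal_ne_top
    _ ≤ ENNReal.ofReal (B / (η / 2)) ^ (((K : ℝ) + 1) / 2) /
        ENNReal.ofReal (Real.exp (c / K * v)) := by gcongr
    _ = _ := by
        rw [ENNReal.ofReal_rpow_of_pos (by positivity), ← ENNReal.ofReal_div_of_pos (Real.exp_pos _),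
          Real.exp_neg, div_eq_mul_inv]

/-- Borel–Cantelli along B = 2^r with the number `K` of scales fixed. At v = (1/4 + ε) (K log B)²
the Markov bound is about B^((K + 1) / 2 - (1 - η) (1/2 + 2 ε) K), at most a constant times 1 / B.
-/
theorem IsDepthLaw.ae_eventually_maxCutCount_lt (hρ : IsDepthLaw ρ) {ε : ℝ} (hε : 0 < ε) :
    ∃ K : ℕ, 0 < K ∧ ∀ᵐ d ∂iidMeasure ρ, ∀ᶠ r : ℕ in atTop,
      (maxCutCount d ((2 ^ r) ^ K) : ℝ) < (1 / 4 + ε) * Real.log ((2 ^ r) ^ K) ^ 2 := by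
  -- Small enough that the loss 1 - η still leaves an exponent of at least (1/2 + ε) K.
  set η := ε / (1 + 2 * ε) with hη
  have hη0 : 0 < η := by positivity
  have hη1 : η < 1 := by rw [hη, div_lt_one (by positivity)]; linarith
  have hηε : 1 / 2 + ε ≤ (1 - η) * (1 / 2 + 2 * ε) := by
    have : (1 - η) = (1 + ε) / (1 + 2 * ε) := by rw [hη]; field_simp; ring
    rw [this, div_mul_eq_mul_div, le_div_iff₀ (by positivity)]
    nlinarith
  -- With ε K ≥ 2, the exponent (1/2 + ε) K exceeds (K + 1) / 2 by at least 1, leaving the summable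
  -- factor 1 / B = 2^(-r).
  obtain ⟨K, hK⟩ := exists_nat_ge (2 / ε)
  have hK0 : (0 : ℝ) < K := lt_of_lt_of_le (by positivity) hK
  have hKε : 2 ≤ ε * K := by rwa [div_le_iff₀' hε] at hK
  refine ⟨K, by exact_mod_cast hK0, ?_⟩
  obtain ⟨r₀, hr₀⟩ := exists_nat_ge (8 / η / Real.log 2)
  have hl2 : 0 < Real.log 2 := Real.log_pos one_lt_two
  set C : ℝ := (1 / (η / 2)) ^ (((K : ℝ) + 1) / 2) with hC
  have hC0 : 0 ≤ C := by positivity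
  have hbound : ∀ r : ℕ, iidMeasure ρ {d | r₀ ≤ r ∧
      (1 / 4 + ε) * Real.log ((2 ^ r) ^ K) ^ 2 ≤ maxCutCount d ((2 ^ r) ^ K)} ≤
      ENNReal.ofReal (C * (1 / 2) ^ r) := fun r => by
    rcases lt_or_ge r r₀ with hr | hr
    · simp [not_le.mpr hr]
    have hr' : (r₀ : ℝ) ≤ r := by exact_mod_cast hr
    have hlog : Real.log ((2 ^ r : ℕ) : ℝ) = r * Real.log 2 := by push_cast; rw [Real.log_pow]
    have hB : 8 / η ≤ Real.log ((2 ^ r : ℕ) : ℝ) := by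
      rw [hlog, ← div_le_iff₀ hl2]
      exact hr₀.trans hr'
    have hlpos : 0 < Real.log ((2 ^ r : ℕ) : ℝ) := lt_of_lt_of_le (by positivity) hB
    have h2 : Real.log (((2 : ℝ) ^ r) ^ K) = K * Real.log ((2 ^ r : ℕ) : ℝ) := by
      push_cast; rw [Real.log_pow]
    refine (measure_mono fun d hd => hd.2).trans ?_
    refine (hρ.measure_le_maxCutCount_le hη0 hη1 hB K).trans (ENNReal.ofReal_le_ofReal ?_)
    rw [h2]
    set l := Real.log ((2 ^ r : ℕ) : ℝ) with hl
    have hexp : 2 * (1 - η) / l / K * ((1 / 4 + ε) * (K * l) ^ 2) =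
        (1 - η) * (1 / 2 + 2 * ε) * K * l := by
      field_simp
      ring
    have hB0 : (0 : ℝ) < ((2 ^ r : ℕ) : ℝ) := by positivity
    rw [hexp, div_eq_mul_one_div, Real.mul_rpow hB0.le (by positivity), mul_comm (_ ^ _) (_ ^ _),
      mul_assoc]
    refine mul_le_mul_of_nonneg_left ?_ hC0
    rw [Real.rpow_def_of_pos hB0, ← hl, ← Real.exp_add]
    have h3 : ((1 : ℝ) / 2) ^ r = Real.exp (-l) := by
      rw [Real.exp_neg, hl, Real.exp_log hB0, one_div, inv_pow]
      push_cast
      rfl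
    rw [h3, Real.exp_le_exp]
    have h4 : (1 / 2 + ε) * K ≤ (1 - η) * (1 / 2 + 2 * ε) * K := by gcongr
    nlinarith
  have hsum : (∑' r : ℕ, iidMeasure ρ {d | r₀ ≤ r ∧
      (1 / 4 + ε) * Real.log ((2 ^ r) ^ K) ^ 2 ≤ maxCutCount d ((2 ^ r) ^ K)}) ≠ ⊤ := by
    refine ne_top_of_le_ne_top ?_ (ENNReal.tsum_le_tsum hbound)
    refine (Summable.tsum_ofReal_lt_top ?_).ne
    exact (summable_geometric_of_lt_one (by norm_num) (by norm_num)).mul_left C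
  filter_upwards [ae_eventually_notMem hsum] with d hd
  filter_upwards [hd, eventually_ge_atTop r₀] with r hr hr'
  by_contra h
  exact hr ⟨hr', not_lt.mp h⟩

theorem IsDepthLaw.ae_eventually_cutCount_le (hρ : IsDepthLaw ρ) {ε : ℝ} (hε : 0 < ε) :
    ∀ᵐ d ∂iidMeasure ρ, ∀ᶠ m : ℕ in atTop,
      (cutCount d 0 m : ℝ) ≤ (1 / 4 + ε) * Real.log m ^ 2 := by
  obtain ⟨K, hK, h⟩ := hρ.ae_eventually_maxCutCount_lt (half_pos hε)
  filter_upwards [h] with d hd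
  -- Between consecutive scales the logarithm changes by the factor 1 + 1 / r, which is absorbed by
  -- the unused ε / 2.
  have hlim : Tendsto (fun r : ℕ => (1 / 4 + ε / 2) * (1 + 1 / (r : ℝ)) ^ 2) atTop
      (nhds ((1 / 4 + ε / 2) * (1 + 0) ^ 2)) :=
    ((tendsto_one_div_atTop_nhds_zero_nat.const_add 1).pow 2).const_mul _
  have hev : ∀ᶠ r : ℕ in atTop, (1 / 4 + ε / 2) * (1 + 1 / (r : ℝ)) ^ 2 < 1 / 4 + ε :=
    hlim.eventually (gt_mem_nhds (by linarith))
  have hlogt : Tendsto (fun m : ℕ => Nat.log (2 ^ K) m) atTop atTop :=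
    tendsto_atTop_atTop.mpr fun b => ⟨(2 ^ K) ^ b, fun a ha =>
      Nat.le_log_of_pow_le (Nat.one_lt_two_pow hK.ne') ha⟩
  filter_upwards [hlogt.eventually ((tendsto_add_atTop_nat 1).eventually hd),
    hlogt.eventually hev, hlogt.eventually (eventually_gt_atTop 0), eventually_gt_atTop 0]
    with m h1 h2 h3 h4
  set r := Nat.log (2 ^ K) m
  have hr0 : (0 : ℝ) < r := by exact_mod_cast h3
  have hlt : m < (2 ^ (r + 1)) ^ K := by
    rw [← pow_mul, mul_comm, pow_mul]
    exact Nat.lt_pow_succ_log_self (Nat.one_lt_two_pow hK.ne') m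
  have hle : ((2 : ℝ) ^ r) ^ K ≤ m := by
    rw [← pow_mul, mul_comm, pow_mul]
    exact_mod_cast Nat.pow_log_le_self (2 ^ K) h4.ne'
  have hl2 : 0 < Real.log 2 := Real.log_pos one_lt_two
  have hlog : K * (r * Real.log 2) ≤ Real.log m := by
    have := Real.log_le_log (by positivity) hle
    rwa [Real.log_pow, Real.log_pow] at this
  have h5 : (cutCount d 0 m : ℝ) ≤ maxCutCount d ((2 ^ (r + 1)) ^ K) := by
    exact_mod_cast cutCount_le_maxCutCount d hlt
  refine h5.trans (h1.le.trans ?_)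
  rw [Real.log_pow, Real.log_pow]
  calc (1 / 4 + ε / 2) * (K * (((r + 1 : ℕ) : ℝ) * Real.log 2)) ^ 2
      = (1 / 4 + ε / 2) * (1 + 1 / (r : ℝ)) ^ 2 * (K * (r * Real.log 2)) ^ 2 := by
        push_cast
        field_simp
    _ ≤ (1 / 4 + ε) * Real.log m ^ 2 := by gcongr

end Depth

/-! ### The lower bound: gaps between cuts, read backwards from a level -/

/-- The level `g` is preceded by a site at distance `g` that was visited exactly once, and by no
such site at a distance in `(a, g)`. -/
def IsFirstCut (a g : ℕ) (d : ℕ → ℕ) : Prop :=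
  IsCut d 0 g ∧ ∀ h, a < h → h < g → ¬ IsCut d (g - h) g

theorem dependsOn_isFirstCut (a g : ℕ) : DependsOn (· ∈ {d | IsFirstCut a g d}) (Set.Iio g) := by
  intro d e h
  have h1 : ∀ s, IsCut d s g = IsCut e s g := fun s => dependsOn_isCut s g h
  simp only [Set.mem_ofPred_eq, IsFirstCut, h1]

theorem measurableSet_of_dependsOn {A : Set (ℕ → ℕ)} {n : ℕ}
    (hA : DependsOn (· ∈ A) (Set.Iio n)) : MeasurableSet A :=
  measurableSet_setOfPred.mpr (measurable_of_dependsOn hA)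

theorem isFirstCut_seqShift (a : ℕ) {g e : ℕ} (hg : g ≤ e) (d : ℕ → ℕ) :
    IsFirstCut a g (seqShift (e - g) d) ↔
      IsCut d (e - g) e ∧ ∀ h, a < h → h < g → ¬ IsCut d (e - h) e := by
  simp only [IsFirstCut, isCut_seqShift, add_zero, Nat.sub_add_cancel hg]
  refine and_congr_right fun _ => forall_congr' fun h => imp_congr_right fun _ =>
    imp_congr_right fun hh => ?_
  rw [show e - g + (g - h) = e - h by omega]

theorem exists_isFirstCut {a g e : ℕ} (hag : a < g) (hg : g ≤ e) {d : ℕ → ℕ}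
    (h : IsCut d (e - g) e) :
    ∃ k ∈ Finset.Ioc a g, IsFirstCut a k (seqShift (e - k) d) := by
  classical
  have hex : ∃ k, a < k ∧ IsCut d (e - k) e := ⟨g, hag, h⟩
  have hle : Nat.find hex ≤ g := Nat.find_min' hex ⟨hag, h⟩
  refine ⟨Nat.find hex, Finset.mem_Ioc.mpr ⟨(Nat.find_spec hex).1, hle⟩, ?_⟩
  rw [isFirstCut_seqShift a (hle.trans hg)]
  exact ⟨(Nat.find_spec hex).2, fun k hak hk hc => Nat.find_min hex hk ⟨hak, hc⟩⟩

section Depth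

variable {ρ : Measure ℕ} [IsProbabilityMeasure ρ]

/-- Decompose according to the nearest cut at distance more than `a` below the level `g`; the site 0
is a cut at that cut too, and the two conditions involve disjoint sets of depths. -/
theorem IsDepthLaw.cutProb_le_sum (hρ : IsDepthLaw ρ) {a g : ℕ} (hag : a < g) :
    cutProb g ≤ ∑ k ∈ Finset.Ioc a g,
      (iidMeasure ρ).real {d | IsFirstCut a k d} * cutProb (g - k) := by
  have hsub : {d | IsCut d 0 g} ⊆ ⋃ k ∈ Finset.Ioc a g,
      {d | IsCut d 0 (g - k)} ∩ seqShift (g - k) ⁻¹' {d | IsFirstCut a k d} := by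
    intro d hd
    obtain ⟨k, hk, h⟩ := exists_isFirstCut (e := g) hag le_rfl (d := d) (by simpa using hd)
    exact Set.mem_biUnion hk ⟨IsCut.mono hd (Nat.sub_le _ _), h⟩
  rw [← hρ.measureReal_isCut]
  refine (measureReal_mono hsub (measure_ne_top _ _)).trans ((measureReal_biUnion_finset_le _ _).trans_eq ?_)
  refine Finset.sum_congr rfl fun k _ => ?_
  rw [measureReal_inter_preimage_seqShift ρ (measurableSet_isCut _ _)
    (dependsOn_isCut 0 (g - k)) (measurableSet_of_dependsOn (dependsOn_isFirstCut a k)),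
    hρ.measureReal_isCut, mul_comm]

/-- Summing the convolution inequality over `g` bounds from below the probability that a first cut
beyond `a` is found within distance `b`, by a ratio of sums of `cutProb`. -/
theorem IsDepthLaw.sum_cutProb_le (hρ : IsDepthLaw ρ) (a b : ℕ) :
    ∑ g ∈ Finset.Ioc a b, cutProb g ≤
      (∑ k ∈ Finset.Ioc a b, (iidMeasure ρ).real {d | IsFirstCut a k d}) *
        ∑ j ∈ Finset.range (b + 1), cutProb j := by
  calc _ ≤ ∑ g ∈ Finset.Ioc a b, ∑ k ∈ Finset.Ioc a g,
        (iidMeasure ρ).real {d | IsFirstCut a k d} * cutProb (g - k) :=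
        Finset.sum_le_sum fun g hg => hρ.cutProb_le_sum (Finset.mem_Ioc.mp hg).1
    _ = ∑ k ∈ Finset.Ioc a b, ∑ g ∈ Finset.Icc k b,
        (iidMeasure ρ).real {d | IsFirstCut a k d} * cutProb (g - k) := by
        refine Finset.sum_comm' fun g k => ?_
        simp only [Finset.mem_Ioc, Finset.mem_Icc]
        omega
    _ ≤ _ := by
        rw [Finset.sum_mul]
        refine Finset.sum_le_sum fun k _ => ?_
        rw [← Finset.mul_sum]
        refine mul_le_mul_of_nonneg_left ?_ measureReal_nonneg
        rw [← Finset.sum_image (f := cutProb) (g := fun g => g - k) (s := Finset.Icc k b)]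
        · refine Finset.sum_le_sum_of_subset_of_nonneg (fun j hj => ?_)
            fun _ _ _ => cutProb_nonneg _
          simp only [Finset.mem_image, Finset.mem_Icc, Finset.mem_range] at hj ⊢
          omega
        · intro x hx y hy hxy
          simp only [Finset.coe_Icc, Set.mem_Icc] at hx hy hxy
          omega

theorem sum_cutProb_pos (b : ℕ) : 0 < ∑ j ∈ Finset.range (b + 1), cutProb j := by
  rw [Finset.sum_range_succ']
  have : cutProb 0 = 1 := by simp [cutProb]
  have : 0 ≤ ∑ j ∈ Finset.range b, cutProb (j + 1) :=
    Finset.sum_nonneg fun _ _ => cutProb_nonneg _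
  linarith

/-- One step backwards: find the first cut beyond distance `a` below `e`. Its position depends only
on the depths from that cut on, so an event about the depths below it remains independent. -/
theorem IsDepthLaw.mul_le_measureReal_exists_isCut (hρ : IsDepthLaw ρ) {a b e : ℕ} (hbe : b ≤ e)
    {A : ℕ → Set (ℕ → ℕ)} (hA : ∀ s, DependsOn (· ∈ A s) (Set.Iio s)) {p : ℝ} (hp0 : 0 ≤ p)
    (hp : ∀ s, e - b ≤ s → p ≤ (iidMeasure ρ).real (A s)) :
    p * ((∑ g ∈ Finset.Ioc a b, cutProb g) / ∑ j ∈ Finset.range (b + 1), cutProb j) ≤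
      (iidMeasure ρ).real {d | ∃ g ∈ Finset.Ioc a b, IsCut d (e - g) e ∧ d ∈ A (e - g)} := by
  have hF := fun k => measurableSet_of_dependsOn (dependsOn_isFirstCut a k)
  have hle : ∀ k ∈ Finset.Ioc a b, k ≤ e := fun k hk => (Finset.mem_Ioc.mp hk).2.trans hbe
  calc _ ≤ p * ∑ k ∈ Finset.Ioc a b, (iidMeasure ρ).real {d | IsFirstCut a k d} := by
        refine mul_le_mul_of_nonneg_left ?_ hp0
        rw [div_le_iff₀ (sum_cutProb_pos b)]
        exact hρ.sum_cutProb_le a b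
    _ ≤ ∑ k ∈ Finset.Ioc a b,
        (iidMeasure ρ).real (A (e - k) ∩ seqShift (e - k) ⁻¹' {d | IsFirstCut a k d}) := by
        rw [Finset.mul_sum]
        refine Finset.sum_le_sum fun k hk => ?_
        rw [measureReal_inter_preimage_seqShift ρ (measurableSet_of_dependsOn (hA _)) (hA _) (hF k)]
        refine mul_le_mul_of_nonneg_right (hp _ ?_) measureReal_nonneg
        have := (Finset.mem_Ioc.mp hk).2
        omega
    _ = (iidMeasure ρ).real (⋃ k ∈ Finset.Ioc a b,
        (A (e - k) ∩ seqShift (e - k) ⁻¹' {d | IsFirstCut a k d})) := by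
        rw [measureReal_biUnion_finset]
        -- A first cut at the larger distance rules out any cut at the smaller one, so the positions
        -- are mutually exclusive and the probabilities add up.
        · have key : ∀ k ∈ Finset.Ioc a b, ∀ l ∈ Finset.Ioc a b, k < l → Disjoint
              (A (e - k) ∩ seqShift (e - k) ⁻¹' {d | IsFirstCut a k d})
              (A (e - l) ∩ seqShift (e - l) ⁻¹' {d | IsFirstCut a l d}) := by
            intro k hk l hl hkl
            refine Set.disjoint_left.mpr fun d h1 h2 => ?_
            have h1 := (isFirstCut_seqShift a (hle k hk) d).mp h1.2
            have h2 := (isFirstCut_seqShift a (hle l hl) d).mp h2.2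
            exact h2.2 k (Finset.mem_Ioc.mp hk).1 hkl h1.1
          intro k hk l hl hkl
          rcases lt_or_gt_of_ne hkl with h | h
          · exact key k hk l hl h
          · exact (key l hl k hk h).symm
        · exact fun k _ => (measurableSet_of_dependsOn (hA _)).inter (measurable_seqShift _ (hF k))
    _ ≤ _ := by
        refine measureReal_mono (Set.iUnion₂_subset fun k hk d hd => ⟨k, hk, ?_, hd.1⟩)
        exact ((isFirstCut_seqShift a (hle k hk) d).mp hd.2).1

theorem succ_le_cutCount {d : ℕ → ℕ} {s m n : ℕ} (hs : s < m) (h : IsCut d s m)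
    (hn : n ≤ cutCount d 0 s) : n + 1 ≤ cutCount d 0 m := by
  classical
  have hsub : insert s ((Finset.Ico 0 s).filter fun t => IsCut d t s) ⊆
      (Finset.Ico 0 m).filter fun t => IsCut d t m := by
    intro t ht
    rw [Finset.mem_insert, Finset.mem_filter, Finset.mem_Ico] at ht
    rw [Finset.mem_filter, Finset.mem_Ico]
    rcases ht with rfl | ⟨⟨_, hts⟩, ht⟩
    · exact ⟨⟨Nat.zero_le _, hs⟩, h⟩
    · exact ⟨⟨Nat.zero_le _, hts.trans hs⟩, (h.isCut_iff hts.le hs.le).mpr ht⟩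
  have := Finset.card_le_card hsub
  rw [Finset.card_insert_of_notMem (by simp)] at this
  exact (Nat.succ_le_succ hn).trans this

theorem dependsOn_le_cutCount (n s : ℕ) :
    DependsOn (· ∈ {d | n ≤ cutCount d 0 s}) (Set.Iio s) := by
  intro d e h
  have : cutCount d 0 s = cutCount e 0 s := dependsOn_cutCount 0 s h
  simp only [Set.mem_ofPred_eq, this]

/-- Going back from `e`, find `n` successive cuts with gaps at most `y`; by the renewal property all
of them are cuts for `e`. -/
theorem IsDepthLaw.pow_le_measureReal_le_cutCount (hρ : IsDepthLaw ρ) (y n : ℕ) {e : ℕ}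
    (he : n * y ≤ e) :
    ((∑ g ∈ Finset.Ioc 0 y, cutProb g) / ∑ j ∈ Finset.range (y + 1), cutProb j) ^ n ≤
      (iidMeasure ρ).real {d | n ≤ cutCount d 0 e} := by
  induction n generalizing e with
  | zero => simp
  | succ n ih =>
    have hny : n * y ≤ e - y := by rw [Nat.succ_mul] at he; omega
    have hye : y ≤ e := by rw [Nat.succ_mul] at he; omega
    rw [pow_succ]
    refine (hρ.mul_le_measureReal_exists_isCut hye (A := fun s => {d | n ≤ cutCount d 0 s})
      (dependsOn_le_cutCount n) (by
        have := sum_cutProb_pos y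
        have : 0 ≤ ∑ g ∈ Finset.Ioc 0 y, cutProb g := Finset.sum_nonneg fun _ _ => cutProb_nonneg _
        positivity) fun s hs => ih (hny.trans hs)).trans (measureReal_mono ?_)
    rintro d ⟨g, hg, hc, hd⟩
    have := Finset.mem_Ioc.mp hg
    exact succ_le_cutCount (by omega) hc hd

theorem dependsOn_le_maxCutCount (V L : ℕ) :
    DependsOn (· ∈ {d | V ≤ maxCutCount d L}) (Set.Iio L) := by
  intro d e h
  have : maxCutCount d L = maxCutCount e L := dependsOn_maxCutCount L h
  simp only [Set.mem_ofPred_eq, this]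

/-- The old cuts lie more than `a` below `W`, and the depths after `W` are too small to reach them,
so they survive and add to the cuts gained in the following window. -/
theorem le_maxCutCount_add {d : ℕ → ℕ} {a g n W L V : ℕ} (hL : 0 < L) (hag : a ≤ g) (hgW : g ≤ W)
    (hc : IsCut d (W - g) W) (hn : n ≤ cutCount d 0 (W - g))
    (hV : V ≤ maxCutCount (seqShift W d) L) (hd : ∀ t < L, d (W + t) < t + max a 1) :
    n + V ≤ maxCutCount d (W + L) := by
  classical
  obtain ⟨m, hm, h⟩ := Finset.exists_mem_eq_sup (Finset.range L)
    (Finset.nonempty_range_iff.mpr hL.ne') (cutCount (seqShift W d) 0)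
  rw [maxCutCount, h, cutCount_seqShift, add_zero] at hV
  have hmL := Finset.mem_range.mp hm
  refine le_trans ?_ (cutCount_le_maxCutCount d (m := W + m) (by omega))
  have hsub : ((Finset.Ico 0 (W - g)).filter fun t => IsCut d t (W - g)) ∪
      ((Finset.Ico W (W + m)).filter fun t => IsCut d t (W + m)) ⊆
      (Finset.Ico 0 (W + m)).filter fun t => IsCut d t (W + m) := by
    intro t ht
    simp only [Finset.mem_union, Finset.mem_filter, Finset.mem_Ico] at ht ⊢
    rcases ht with ⟨⟨_, ht⟩, h⟩ | ⟨ht, h⟩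
    · refine ⟨by omega, fun i hi => ?_⟩
      rcases lt_or_ge (t + i) W with h' | h'
      · exact (hc.isCut_iff ht.le (Nat.sub_le _ _)).mpr h i h'
      · obtain ⟨j, hj⟩ := Nat.exists_eq_add_of_le h'
        have := hd j (by omega)
        rw [hj]
        omega
    · exact ⟨by omega, h⟩
  have hcard := Finset.card_le_card hsub
  rw [Finset.card_union_of_disjoint] at hcard
  · exact (Nat.add_le_add hn hV).trans hcard
  · refine Finset.disjoint_left.mpr fun t h1 h2 => ?_
    simp only [Finset.mem_filter, Finset.mem_Ico] at h1 h2
    omega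

/-- A depth is at least t + a with probability 1 / (t + a + 1) ≤ 1 / a; the bound sums this over the
`L` levels. -/
theorem IsDepthLaw.measureReal_exists_le (hρ : IsDepthLaw ρ) {a L : ℕ} (ha : 0 < a) :
    (iidMeasure ρ).real {d | ∀ t < L, d t < t + max a 1}ᶜ ≤ L / a := by
  have hsub : {d : ℕ → ℕ | ∀ t < L, d t < t + max a 1}ᶜ ⊆
      ⋃ t ∈ Finset.range L, (fun d : ℕ → ℕ => d t) ⁻¹' (Set.Iio (t + a))ᶜ := by
    intro d hd
    simp only [Set.mem_compl_iff, Set.mem_ofPred_eq, not_forall] at hd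
    obtain ⟨t, ht, h⟩ := hd
    refine Set.mem_biUnion (Finset.mem_coe.mpr (Finset.mem_range.mpr ht)) ?_
    simp only [Set.mem_preimage, Set.mem_compl_iff, Set.mem_Iio]
    omega
  refine (measureReal_mono hsub (measure_ne_top _ _)).trans ((measureReal_biUnion_finset_le _ _).trans ?_)
  have h1 : ∀ t ∈ Finset.range L,
      (iidMeasure ρ).real ((fun d : ℕ → ℕ => d t) ⁻¹' (Set.Iio (t + a))ᶜ) ≤ 1 / a := by
    intro t _
    have := (measurePreserving_eval_infinitePi (fun _ : ℕ => ρ) t).measureReal_preimage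
      (measurableSet_Iio (a := t + a)).compl.nullMeasurableSet
    change (iidMeasure ρ).real (Function.eval t ⁻¹' (Set.Iio (t + a))ᶜ) ≤ _
    rw [this, probReal_compl_eq_one_sub measurableSet_Iio, hρ]
    have ha' : (0 : ℝ) < a := by exact_mod_cast ha
    push_cast
    rw [one_sub_div (by positivity)]
    rw [div_le_div_iff₀ (by positivity) ha']
    nlinarith [(Nat.cast_nonneg t : (0 : ℝ) ≤ t)]
  refine (Finset.sum_le_sum h1).trans_eq ?_
  rw [Finset.sum_const, Finset.card_range, nsmul_eq_mul, mul_one_div]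

theorem maxCutCount_seqShift_le (d : ℕ → ℕ) (l L : ℕ) :
    maxCutCount (seqShift l d) L ≤ maxCutCount d (l + L) := by
  refine Finset.sup_le fun m hm => ?_
  rw [cutCount_seqShift, add_zero]
  exact (cutCount_anti_left d _ (Nat.zero_le _)).trans
    (cutCount_le_maxCutCount d (by have := Finset.mem_range.mp hm; omega))

theorem maxCutCount_mono (d : ℕ → ℕ) {L M : ℕ} (h : L ≤ M) : maxCutCount d L ≤ maxCutCount d M :=
  Finset.sup_mono (Finset.range_mono h)

/-- Success inside any one of `J` disjoint blocks suffices, since a cut of a block is also a cut of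
the whole sequence. The blocks are independent. -/
theorem measureReal_maxCutCount_mul_lt_le (l V J : ℕ) :
    (iidMeasure ρ).real {d | V ≤ maxCutCount d (J * l)}ᶜ ≤
      ((iidMeasure ρ).real {d | V ≤ maxCutCount d l}ᶜ) ^ J := by
  induction J with
  | zero => simp
  | succ J ih =>
    have hm := fun L => (measurableSet_of_dependsOn (dependsOn_le_maxCutCount V L)).compl
    have hsub : {d | V ≤ maxCutCount d ((J + 1) * l)}ᶜ ⊆ {d | V ≤ maxCutCount d l}ᶜ ∩
        seqShift l ⁻¹' {d | V ≤ maxCutCount d (J * l)}ᶜ := by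
      intro d hd
      simp only [Set.mem_compl_iff, Set.mem_ofPred_eq, Set.mem_inter_iff, Set.mem_preimage] at hd ⊢
      rw [Nat.succ_mul, add_comm] at hd
      exact ⟨fun h => hd (h.trans (maxCutCount_mono d (Nat.le_add_right _ _))),
        fun h => hd (h.trans (maxCutCount_seqShift_le d l _))⟩
    refine (measureReal_mono hsub).trans ?_
    rw [measureReal_inter_preimage_seqShift ρ (hm l) _ (hm _), pow_succ']
    · exact mul_le_mul_of_nonneg_left ih measureReal_nonneg
    · intro d e h
      have := dependsOn_le_maxCutCount V l h
      simp only [Set.mem_compl_iff]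
      exact congrArg Not this

end Depth

section Depth

variable {ρ : Measure ℕ} [IsProbabilityMeasure ρ]

/-- One trial of length (n + 1) y + L: `n` gaps of at most `y`, one further gap in (4 L, y] as
protection, then a window of length `L` with `V` cuts. The protection fails with probability at most
L / a = 1/4, and 1/2 - 1/4 is the factor 1/4. -/
theorem IsDepthLaw.le_measureReal_composite (hρ : IsDepthLaw ρ) {a y n L V : ℕ} (hL : 0 < L)
    (ha : a = 4 * L) (hV : 1 / 2 ≤ (iidMeasure ρ).real {d | V ≤ maxCutCount d L}) :
    ((∑ g ∈ Finset.Ioc 0 y, cutProb g) / ∑ j ∈ Finset.range (y + 1), cutProb j) ^ n *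
      ((∑ g ∈ Finset.Ioc a y, cutProb g) / ∑ j ∈ Finset.range (y + 1), cutProb j) / 4 ≤
      (iidMeasure ρ).real {d | n + V ≤ maxCutCount d ((n + 1) * y + L)} := by
  set W := (n + 1) * y with hW
  have hyW : y ≤ W := by rw [hW, Nat.succ_mul]; omega
  have hnW : n * y ≤ W - y := by rw [hW, Nat.succ_mul]; omega
  have hs : 0 ≤ ∑ g ∈ Finset.Ioc 0 y, cutProb g := Finset.sum_nonneg fun _ _ => cutProb_nonneg _
  have hs' : 0 ≤ ∑ g ∈ Finset.Ioc a y, cutProb g := Finset.sum_nonneg fun _ _ => cutProb_nonneg _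
  have hU := sum_cutProb_pos y
  have h1 := hρ.mul_le_measureReal_exists_isCut (a := a) hyW
    (A := fun s => {d | n ≤ cutCount d 0 s}) (dependsOn_le_cutCount n)
    (p := ((∑ g ∈ Finset.Ioc 0 y, cutProb g) / ∑ j ∈ Finset.range (y + 1), cutProb j) ^ n)
    (by positivity) fun s hs => hρ.pow_le_measureReal_le_cutCount y n (hnW.trans hs)
  set A := {d | ∃ g ∈ Finset.Ioc a y, IsCut d (W - g) W ∧ n ≤ cutCount d 0 (W - g)} with hA
  have hAdep : DependsOn (· ∈ A) (Set.Iio W) := by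
    intro d e h
    simp only [hA, Set.mem_ofPred_eq, eq_iff_iff]
    refine exists_congr fun g => and_congr_right fun hg => ?_
    have h1 : IsCut d (W - g) W = IsCut e (W - g) W := dependsOn_isCut _ _ h
    have h2 : cutCount d 0 (W - g) = cutCount e 0 (W - g) := dependsOn_cutCount _ _ fun i hi =>
      h i (Set.mem_Iio.mpr ((Set.mem_Iio.mp hi).trans_le (Nat.sub_le _ _)))
    rw [h1, h2]
  set N : Set (ℕ → ℕ) := {d | ∀ t < L, d t < t + max a 1} with hN
  have hNdep : DependsOn (· ∈ N) (Set.Iio L) := by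
    intro d e h
    simp only [hN, Set.mem_ofPred_eq, eq_iff_iff]
    refine forall_congr' fun t => imp_congr_right fun ht => ?_
    rw [h t (Set.mem_Iio.mpr ht)]
  have hNm := measurableSet_of_dependsOn hNdep
  set H := {d | V ≤ maxCutCount d L} with hH
  have hHm : MeasurableSet H := measurableSet_of_dependsOn (dependsOn_le_maxCutCount V L)
  have hNc : (iidMeasure ρ).real Nᶜ ≤ 1 / 4 := by
    refine (hρ.measureReal_exists_le (by omega)).trans_eq ?_
    rw [ha]
    push_cast
    have : (0 : ℝ) < L := by exact_mod_cast hL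
    field_simp
  have hHN : 1 / 4 ≤ (iidMeasure ρ).real (H ∩ N) := by
    have : (iidMeasure ρ).real H ≤ (iidMeasure ρ).real (H ∩ N) + (iidMeasure ρ).real Nᶜ := by
      refine (measureReal_mono (s₂ := (H ∩ N) ∪ Nᶜ) fun d hd => ?_).trans
        (measureReal_union_le _ _)
      by_cases h : d ∈ N
      · exact Or.inl ⟨hd, h⟩
      · exact Or.inr h
    linarith
  calc _ ≤ (iidMeasure ρ).real A * (iidMeasure ρ).real (H ∩ N) := by
        rw [div_eq_mul_one_div]
        exact mul_le_mul h1 hHN (by norm_num) measureReal_nonneg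
    _ = (iidMeasure ρ).real (A ∩ seqShift W ⁻¹' (H ∩ N)) :=
        (measureReal_inter_preimage_seqShift ρ (measurableSet_of_dependsOn hAdep) hAdep
          (hHm.inter hNm)).symm
    _ ≤ _ := by
        refine measureReal_mono ?_
        rintro d ⟨⟨g, hg, hc, hn⟩, hd, hd'⟩
        have hg' := Finset.mem_Ioc.mp hg
        exact le_maxCutCount_add hL hg'.1.le (hg'.2.trans hyW) hc hn hd hd'

theorem sum_Ioc_zero_cutProb (y : ℕ) : ∑ g ∈ Finset.Ioc 0 y, cutProb g = (harmonic y : ℝ) / 2 := by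
  have h := sum_cutProb y
  rw [Finset.sum_range_succ'] at h
  have h0 : cutProb 0 = 1 := by simp [cutProb]
  have : ∑ g ∈ Finset.Ioc 0 y, cutProb g = ∑ j ∈ Finset.range y, cutProb (j + 1) := by
    rw [Finset.range_eq_Ico, Finset.sum_Ico_add' cutProb 0 y 1]
    rfl
  rw [this]
  linarith

/-- With h half the harmonic number, the ratio is h / (1 + h) ≥ exp (-1 / h), and h ≥ (log y) / 2.
This matches the cost exp (-2 n / log y) of the upper bound. -/
theorem exp_neg_le_ratio_pow {y : ℕ} (hy : 2 ≤ y) (n : ℕ) :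
    Real.exp (-(2 * n / Real.log y)) ≤
      ((∑ g ∈ Finset.Ioc 0 y, cutProb g) / ∑ j ∈ Finset.range (y + 1), cutProb j) ^ n := by
  have hy' : (1 : ℝ) < y := by exact_mod_cast hy
  have hlog : 0 < Real.log y := Real.log_pos hy'
  have hH : Real.log y ≤ harmonic y := by
    refine le_trans ?_ (log_add_one_le_harmonic y)
    exact Real.log_le_log (by linarith) (by push_cast; linarith)
  rw [sum_Ioc_zero_cutProb, sum_cutProb]
  set h : ℝ := (harmonic y : ℝ) / 2 with hh
  have hh0 : 0 < h := by linarith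
  have h1 : Real.exp (-(1 / h)) ≤ h / (1 + h) := by
    rw [Real.exp_neg, inv_le_comm₀ (Real.exp_pos _) (by positivity), inv_div]
    have := Real.add_one_le_exp (1 / h)
    calc (1 + h) / h = 1 / h + 1 := by field_simp
      _ ≤ _ := this
  calc _ ≤ Real.exp (n * -(1 / h)) := by
        rw [Real.exp_le_exp, mul_neg, neg_le_neg_iff, mul_one_div, mul_comm 2 (n : ℝ),
          mul_div_assoc]
        rw [div_eq_mul_one_div (n : ℝ) h]
        refine mul_le_mul_of_nonneg_left ?_ (Nat.cast_nonneg _)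
        rw [div_le_div_iff₀ hh0 hlog]
        linarith
    _ = Real.exp (-(1 / h)) ^ n := Real.exp_nat_mul _ _
    _ ≤ _ := by gcongr

/-- At least half of the distances up to `y` exceed `a`, each contributing at least 1 / (2 y). The
protective gap thus costs only a logarithmic factor. -/
theorem le_ratio {a y : ℕ} (hy : 0 < y) (hay : 2 * a ≤ y) :
    1 / (4 * (2 + Real.log y)) ≤
      (∑ g ∈ Finset.Ioc a y, cutProb g) / ∑ j ∈ Finset.range (y + 1), cutProb j := by
  have hy' : (0 : ℝ) < y := by exact_mod_cast hy
  have hlog : 0 ≤ Real.log y := Real.log_natCast_nonneg y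
  have hH := harmonic_le_one_add_log y
  have hnum : 1 / 4 ≤ ∑ g ∈ Finset.Ioc a y, cutProb g := by
    calc (1 : ℝ) / 4 ≤ ∑ g ∈ Finset.Ioc a y, (1 : ℝ) / (2 * y) := by
          rw [Finset.sum_const, Nat.card_Ioc, nsmul_eq_mul, Nat.cast_sub (by omega), mul_one_div,
            div_le_div_iff₀ (by norm_num) (by positivity)]
          have : (2 * a : ℝ) ≤ y := by exact_mod_cast hay
          linarith
      _ ≤ _ := by
          refine Finset.sum_le_sum fun g hg => ?_
          have := Finset.mem_Ioc.mp hg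
          rw [cutProb, if_neg (by omega)]
          have h0 : (0 : ℝ) < g := by exact_mod_cast (by omega : 0 < g)
          have h1 : (g : ℝ) ≤ y := by exact_mod_cast this.2
          gcongr
  have hU := sum_cutProb_pos y
  rw [div_le_div_iff₀ (by positivity) hU, sum_cutProb]
  nlinarith

/-- A trial succeeds with probability about β^(-(R - 3)) and there are about β^(R - 1) trials, up to
powers of log β; the surplus β² absorbs these. -/
theorem one_le_mul_of_log_bounds {β R n J : ℕ} {c k p : ℝ} (hβ8 : 8 ≤ β) (hR : 4 ≤ R)
    (hl1 : 1 ≤ Real.log β) (hc0 : 0 ≤ c) (hk : 1 ≤ k) (hnle : (n : ℝ) ≤ c * Real.log β ^ 2)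
    (hβ : 32 * ((c + 2) * (2 + k)) * Real.log β ^ 3 ≤ β)
    (hp : Real.exp (-((R - 3) * Real.log β)) * (1 / (4 * (2 + k * Real.log β))) / 4 ≤ p)
    (hJ1 : (β : ℝ) ^ (R - 1) / (n + 2) - 1 ≤ J) : 1 ≤ p * J := by
  have hβr : (8 : ℝ) ≤ β := by exact_mod_cast hβ8
  have hR' : (4 : ℝ) ≤ R := by exact_mod_cast hR
  set l := Real.log β with hl
  have hn2 : (n : ℝ) + 2 ≤ (c + 2) * l ^ 2 := by nlinarith
  have hCβ : 32 * (n + 2) * (2 + k * l) ≤ (β : ℝ) := by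
    refine le_trans ?_ hβ
    have h1 : 2 + k * l ≤ (2 + k) * l := by nlinarith
    have h2 : 0 ≤ 2 + k * l := by positivity
    calc 32 * (n + 2) * (2 + k * l)
        ≤ 32 * ((c + 2) * l ^ 2) * ((2 + k) * l) := by gcongr
      _ = 32 * ((c + 2) * (2 + k)) * l ^ 3 := by ring
  have hn20 : (0 : ℝ) < n + 2 := by positivity
  have hD0 : 0 < 2 + k * l := by positivity
  have hD1 : 1 ≤ 2 + k * l := by
    have : 0 ≤ k * l := by positivity
    linarith
  have hβn : 2 * (n + 2) ≤ (β : ℝ) ^ (R - 1) := by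
    have h1 : (β : ℝ) ≤ (β : ℝ) ^ (R - 1) := le_self_pow₀ (by linarith) (by omega)
    nlinarith
  have hJ2 : (β : ℝ) ^ (R - 1) / (2 * (n + 2)) ≤ J := by
    refine le_trans ?_ hJ1
    rw [div_le_iff₀ (by positivity)]
    have : ((β : ℝ) ^ (R - 1) / (n + 2) - 1) * (2 * (n + 2)) =
      2 * (β : ℝ) ^ (R - 1) - 2 * (n + 2) := by field_simp
    rw [this]; linarith
  have hexp : Real.exp (-((R - 3) * l)) * (β : ℝ) ^ (R - 1) = (β : ℝ) ^ 2 := by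
    have hb : (β : ℝ) = Real.exp l := (Real.exp_log (by linarith)).symm
    rw [hb, ← Real.exp_nat_mul, ← Real.exp_nat_mul, ← Real.exp_add, Nat.cast_sub (by omega)]
    congr 1
    push_cast
    ring
  calc (1 : ℝ) ≤ (β : ℝ) ^ 2 / (32 * (n + 2) * (2 + k * l)) := by
        rw [one_le_div (by positivity)]
        nlinarith
    _ = Real.exp (-((R - 3) * l)) * (1 / (4 * (2 + k * l))) / 4 *
        ((β : ℝ) ^ (R - 1) / (2 * (n + 2))) := by
        rw [← hexp]; field_simp; ring
    _ ≤ p * J := by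
        refine mul_le_mul hp hJ2 (by positivity) (le_trans (by positivity) hp)

/-- The gain from scale β^(R i) to β^(R (i + 1)). A run of n cuts with gaps at most β^(R i + 1)
costs about exp (-2 n / ((R i + 1) log β)), and this n is chosen to make it at least β^(-(R - 3)),
affordable with about β^(R - 1) blocks. -/
theorem IsDepthLaw.half_le_measureReal_step (hρ : IsDepthLaw ρ) {R : ℕ} (hR : 4 ≤ R) (i : ℕ) :
    ∀ᶠ β : ℕ in atTop, ∀ V : ℕ,
      1 / 2 ≤ (iidMeasure ρ).real {d | V ≤ maxCutCount d (β ^ (R * i))} →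
      1 / 2 ≤ (iidMeasure ρ).real {d | ⌊(R * (R - 3) / 2 * i * Real.log β ^ 2 : ℝ)⌋₊ + V ≤
        maxCutCount d (β ^ (R * (i + 1)))} := by
  set c : ℝ := R * (R - 3) / 2 * i with hc
  have hR' : (4 : ℝ) ≤ R := by exact_mod_cast hR
  have hi0 : (0 : ℝ) ≤ i := Nat.cast_nonneg i
  have hc0 : 0 ≤ c := by rw [hc]; have : (0 : ℝ) ≤ R - 3 := by linarith
                         positivity
  have hlogt : Tendsto (fun β : ℕ => Real.log β) atTop atTop :=
    Real.tendsto_log_atTop.comp tendsto_natCast_atTop_atTop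
  set C : ℝ := 32 * ((c + 2) * (2 + (R * i + 1))) with hC
  have hC0 : 0 < C := by positivity
  have hlo : ∀ᶠ β : ℕ in atTop, C * Real.log β ^ 3 ≤ β := by
    have := (Real.isLittleO_pow_log_id_atTop (n := 3)).bound (inv_pos.mpr hC0)
    filter_upwards [tendsto_natCast_atTop_atTop.eventually this, eventually_ge_atTop 1] with β hβ h1
    have hl : 0 ≤ Real.log β := Real.log_natCast_nonneg β
    rw [Real.norm_of_nonneg (by positivity), id, Real.norm_of_nonneg (Nat.cast_nonneg _)] at hβ
    rwa [inv_mul_eq_div, le_div_iff₀' hC0] at hβ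
  filter_upwards [hlo, hlogt.eventually_ge_atTop 1, eventually_ge_atTop 8] with β hβ hl1 hβ8 V hV
  set l := Real.log β with hl
  set n := ⌊(c * l ^ 2 : ℝ)⌋₊ with hn
  have hβ0 : 0 < β := by omega
  have hβr : (8 : ℝ) ≤ β := by exact_mod_cast hβ8
  set L := β ^ (R * i) with hL
  have hL0 : 0 < L := by positivity
  -- One factor β above `L`, so that a gap in (4 L, y] is available, while most of the R factors β
  -- remain for the number of blocks.
  set y := β ^ (R * i + 1) with hy
  have hyL : y = β * L := by rw [hy, hL, pow_succ, mul_comm]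
  have hy0 : 0 < y := by positivity
  have hlogy : Real.log y = (R * i + 1) * l := by
    rw [hy]; push_cast; rw [Real.log_pow]; push_cast; rfl
  have hnle : (n : ℝ) ≤ c * l ^ 2 := Nat.floor_le (by positivity)
  have hcomp := hρ.le_measureReal_composite (y := y) (n := n) hL0 rfl hV
  set ℓ := (n + 1) * y + L with hℓ
  set p := (iidMeasure ρ).real {d | n + V ≤ maxCutCount d ℓ} with hp
  have hp_lower : Real.exp (-((R - 3) * l)) * (1 / (4 * (2 + (R * i + 1) * l))) / 4 ≤ p := by
    refine le_trans ?_ hcomp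
    have hy2 : 2 ≤ y := by rw [hyL]; nlinarith
    have h1 := exp_neg_le_ratio_pow hy2 n
    have h2 := le_ratio (a := 4 * L) hy0 (by rw [hyL]; nlinarith)
    rw [hlogy] at h1 h2
    have h3 : Real.exp (-((R - 3) * l)) ≤ Real.exp (-(2 * n / ((R * i + 1) * l))) := by
      rw [Real.exp_le_exp, neg_le_neg_iff, div_le_iff₀ (by positivity)]
      have : 2 * (n : ℝ) ≤ R * (R - 3) * i * l ^ 2 := by
        refine (mul_le_mul_of_nonneg_left hnle zero_le_two).trans_eq ?_
        rw [hc]; ring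
      have h4 : 0 ≤ (R - 3 : ℝ) * l ^ 2 := mul_nonneg (by linarith) (by positivity)
      nlinarith
    have h5 := h3.trans h1
    have h6 : 0 ≤ 1 / (4 * (2 + (R * i + 1) * l)) := by positivity
    have h7 := mul_le_mul h5 h2 h6 ((Real.exp_pos _).le.trans h5)
    linarith
  -- The number of disjoint trials of length `ℓ` that fit into the larger scale. Once p J ≥ 1, all
  -- of them fail with probability at most exp (-1) ≤ 1/2.
  set J := β ^ (R * (i + 1)) / ℓ with hJ
  have hℓ0 : 0 < ℓ := by omega
  have hJℓ : J * ℓ ≤ β ^ (R * (i + 1)) := Nat.div_mul_le_self _ _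
  have hpJ : 1 ≤ p * J := by
    have hR1 : β ^ (R * (i + 1)) = β ^ (R - 1) * y := by
      rw [hy, ← pow_add]; congr 1; rw [mul_add]; omega
    have hℓy : ℓ ≤ (n + 2) * y := by
      have : L ≤ y := by rw [hyL]; nlinarith
      rw [hℓ]; nlinarith
    have hJ1 : (β : ℝ) ^ (R - 1) / (n + 2) - 1 ≤ J := by
      have : β ^ (R - 1) / (n + 2) ≤ J := by
        rw [hJ, hR1]
        calc β ^ (R - 1) / (n + 2) = (β ^ (R - 1) * y) / ((n + 2) * y) :=
              (Nat.mul_div_mul_right _ _ hy0).symm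
          _ ≤ _ := Nat.div_le_div_left hℓy hℓ0
      have h2 := Nat.lt_floor_add_one ((β : ℝ) ^ (R - 1) / (n + 2))
      have h3 : ⌊(β : ℝ) ^ (R - 1) / (n + 2)⌋₊ = β ^ (R - 1) / (n + 2) := by
        have := Nat.floor_div_eq_div (K := ℝ) (β ^ (R - 1)) (n + 2)
        push_cast at this
        exact this
      rw [h3] at h2
      have h4 : ((β ^ (R - 1) / (n + 2) : ℕ) : ℝ) ≤ J := by exact_mod_cast this
      linarith
    exact one_le_mul_of_log_bounds hβ8 hR hl1 hc0 (by nlinarith) hnle hβ hp_lower hJ1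
  have hmeas := fun M => measurableSet_of_dependsOn (dependsOn_le_maxCutCount (n + V) M)
  have hfail := measureReal_maxCutCount_mul_lt_le (ρ := ρ) ℓ (n + V) J
  rw [probReal_compl_eq_one_sub (hmeas _), probReal_compl_eq_one_sub (hmeas _), ← hp] at hfail
  have hp1 : p ≤ 1 := measureReal_le_one
  have hpow : (1 - p) ^ J ≤ 1 / 2 := by
    calc (1 - p) ^ J ≤ Real.exp (-p) ^ J := by
          have := Real.one_sub_le_exp_neg p
          gcongr
      _ = Real.exp (-(p * J)) := by rw [← Real.exp_nat_mul]; congr 1; ring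
      _ ≤ Real.exp (-1) := by rw [Real.exp_le_exp]; linarith
      _ ≤ 1 / 2 := by
          rw [Real.exp_neg, one_div]
          exact inv_anti₀ two_pos (by linarith [Real.add_one_le_exp (1 : ℝ)])
  have hmono : (iidMeasure ρ).real {d | n + V ≤ maxCutCount d (J * ℓ)} ≤
      (iidMeasure ρ).real {d | n + V ≤ maxCutCount d (β ^ (R * (i + 1)))} :=
    measureReal_mono fun d hd => le_trans hd (maxCutCount_mono d hJℓ)
  linarith

end Depth

section Depth

variable {ρ : Measure ℕ} [IsProbabilityMeasure ρ]

theorem IsDepthLaw.half_le_measureReal_sum (hρ : IsDepthLaw ρ) {R : ℕ} (hR : 4 ≤ R) (K : ℕ) :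
    ∀ᶠ β : ℕ in atTop, 1 / 2 ≤ (iidMeasure ρ).real
      {d | ∑ i ∈ Finset.range K, ⌊(R * (R - 3) / 2 * i * Real.log β ^ 2 : ℝ)⌋₊ ≤
        maxCutCount d (β ^ (R * K))} := by
  induction K with
  | zero => exact Eventually.of_forall fun β => by simp; norm_num
  | succ K ih =>
    filter_upwards [ih, hρ.half_le_measureReal_step hR K] with β h1 h2
    rw [Finset.sum_range_succ, add_comm]
    exact h2 _ h1

theorem sum_floor_ge (x : ℝ) (K : ℕ) :
    x * (K * (K - 1) / 2) - K ≤ ((∑ i ∈ Finset.range K, ⌊x * i⌋₊ : ℕ) : ℝ) := by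
  induction K with
  | zero => simp
  | succ K ih =>
    rw [Finset.sum_range_succ]
    have h := Nat.lt_floor_add_one (x * K)
    have h1 : x * ((K + 1 : ℝ) * (K + 1 - 1) / 2) = x * (K * (K - 1) / 2) + x * K := by ring
    rw [Nat.cast_add _ ⌊x * K⌋₊, Nat.cast_add_one, h1]
    linarith

/-- Summing the gains over R scales gives about R⁴ (log β)² / 4, which is one quarter of the square
of log β^(R²). -/
theorem IsDepthLaw.half_le_measureReal_maxCutCount (hρ : IsDepthLaw ρ) {ε : ℝ} (hε : 0 < ε) :
    ∃ Q : ℕ, 0 < Q ∧ ∀ᶠ β : ℕ in atTop, 1 / 2 ≤ (iidMeasure ρ).real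
      {d | ⌈(1 / 4 - ε) * Real.log ((β : ℝ) ^ Q) ^ 2⌉₊ ≤ maxCutCount d (β ^ Q)} := by
  -- With ε R ≥ 2, the allowance ε R⁴ (log β)² covers the losses R³ (log β)² and R.
  obtain ⟨R, hR⟩ := exists_nat_ge (max 4 (2 / ε))
  have hR4' : (4 : ℝ) ≤ R := (le_max_left _ _).trans hR
  have hR4 : 4 ≤ R := by exact_mod_cast hR4'
  have hRε : 2 ≤ ε * R := by
    have := (le_max_right _ _).trans hR
    rwa [div_le_iff₀' hε] at this
  have hlogt : Tendsto (fun β : ℕ => Real.log β) atTop atTop :=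
    Real.tendsto_log_atTop.comp tendsto_natCast_atTop_atTop
  refine ⟨R * R, by positivity, ?_⟩
  filter_upwards [hρ.half_le_measureReal_sum hR4 R, hlogt.eventually_ge_atTop 1] with β h1 hl
  refine h1.trans (measureReal_mono fun d hd => le_trans (Nat.ceil_le.mpr ?_) hd)
  have h2 : ∀ i : ℕ, (R * (R - 3) / 2 * i * Real.log β ^ 2 : ℝ) =
      R * (R - 3) / 2 * Real.log β ^ 2 * i := fun i => by ring
  simp_rw [h2]
  set l := Real.log β
  have hR3 : (0 : ℝ) ≤ R - 3 := by linarith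
  refine le_trans ?_ (sum_floor_ge _ R)
  rw [Real.log_pow]
  push_cast
  have hl2 : 1 ≤ l ^ 2 := by nlinarith
  have hR0 : (0 : ℝ) < R := by linarith
  have h3 : R ≤ (R : ℝ) ^ 3 * l ^ 2 := by
    have : (R : ℝ) ≤ (R : ℝ) ^ 3 := le_self_pow₀ (by linarith) (by norm_num)
    nlinarith [pow_pos hR0 3]
  have h4 : 2 * ((R : ℝ) ^ 3 * l ^ 2) ≤ ε * R * ((R : ℝ) ^ 3 * l ^ 2) := by gcongr
  have h5 : 0 ≤ (R : ℝ) ^ 2 * l ^ 2 := by positivity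
  have h6 : (R * (R - 3) / 2 * l ^ 2 * (R * (R - 1) / 2) - R : ℝ) =
      R ^ 4 * l ^ 2 / 4 - R ^ 3 * l ^ 2 + 3 / 4 * (R ^ 2 * l ^ 2) - R := by ring
  have h7 : (1 / 4 - ε) * (R * R * l) ^ 2 = R ^ 4 * l ^ 2 / 4 - ε * R * (R ^ 3 * l ^ 2) := by ring
  rw [h6, h7]
  linarith

/-- The stretches [M r, 2 M r) are disjoint, so the successes in them are independent; n consecutive
failures have probability at most 2^(-n). -/
theorem ae_frequently_of_half_le {M v : ℕ → ℕ} (hM : ∀ r, 2 * M r ≤ M (r + 1)) (r₀ : ℕ)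
    (h : ∀ r ≥ r₀, 1 / 2 ≤ (iidMeasure ρ).real {d | v r ≤ maxCutCount d (M r)}) :
    ∀ᵐ d ∂iidMeasure ρ, ∃ᶠ r in atTop, v r ≤ maxCutCount (seqShift (M r) d) (M r) := by
  set B : ℕ → Set (ℕ → ℕ) := fun r => {d | v r ≤ maxCutCount d (M r)}ᶜ with hB
  have hBm : ∀ r, MeasurableSet (B r) := fun r =>
    (measurableSet_of_dependsOn (dependsOn_le_maxCutCount _ _)).compl
  have hB2 : ∀ r ≥ r₀, (iidMeasure ρ).real (B r) ≤ 1 / 2 := fun r hr => by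
    rw [hB, probReal_compl_eq_one_sub (measurableSet_of_dependsOn (dependsOn_le_maxCutCount _ _))]
    linarith [h r hr]
  have hpow : ∀ k ≥ r₀, ∀ n,
      DependsOn (· ∈ {d | ∀ r, k ≤ r → r < k + n → seqShift (M r) d ∈ B r}) (Set.Iio (M (k + n))) ∧
      (iidMeasure ρ).real {d | ∀ r, k ≤ r → r < k + n → seqShift (M r) d ∈ B r} ≤
        (1 / 2) ^ n := by
    intro k hk n
    induction n with
    | zero =>
      refine ⟨fun d e _ => ?_, by simp⟩
      simp only [Set.mem_ofPred_eq, eq_iff_iff]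
      exact ⟨fun _ r h1 h2 => by omega, fun _ r h1 h2 => by omega⟩
    | succ n ih =>
      have heq : {d | ∀ r, k ≤ r → r < k + (n + 1) → seqShift (M r) d ∈ B r} =
          {d | ∀ r, k ≤ r → r < k + n → seqShift (M r) d ∈ B r} ∩
            seqShift (M (k + n)) ⁻¹' B (k + n) := by
        ext d
        constructor
        · exact fun hd => ⟨fun r h1 h2 => hd r h1 (by omega), hd _ (by omega) (by omega)⟩
        · rintro ⟨h1, h2⟩ r h3 h4
          rcases Nat.lt_succ_iff_lt_or_eq.mp h4 with h5 | rfl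
          · exact h1 r h3 h5
          · exact h2
      have hMn := hM (k + n)
      rw [heq]
      constructor
      · intro d e hde
        have h1 := ih.1 (x := d) (y := e) fun i hi => hde i (Set.mem_Iio.mpr (by
          have := Set.mem_Iio.mp hi
          rw [← add_assoc]; omega))
        have h2 := dependsOn_le_maxCutCount (v (k + n)) (M (k + n))
          (x := seqShift (M (k + n)) d) (y := seqShift (M (k + n)) e) fun i hi =>
          hde _ (Set.mem_Iio.mpr (by
            have := Set.mem_Iio.mp hi
            rw [← add_assoc]; omega))
        simp only [Set.mem_inter_iff, Set.mem_preimage] at h1 h2 ⊢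
        rw [h1]
        simp only [hB, Set.mem_compl_iff, h2]
      · rw [measureReal_inter_preimage_seqShift ρ (measurableSet_of_dependsOn ih.1) ih.1 (hBm _),
          pow_succ]
        exact mul_le_mul ih.2 (hB2 _ (by omega)) measureReal_nonneg (by positivity)
  have hzero : ∀ k ≥ r₀,
      iidMeasure ρ {d | ∀ r, k ≤ r → seqShift (M r) d ∈ B r} = 0 := by
    intro k hk
    rw [← measureReal_eq_zero_iff]
    refine le_antisymm ?_ measureReal_nonneg
    refine ge_of_tendsto' (tendsto_pow_atTop_nhds_zero_of_lt_one (r := (1 / 2 : ℝ))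
      (by norm_num) (by norm_num)) fun n => ?_
    refine (measureReal_mono ?_).trans (hpow k hk n).2
    exact fun d (hd : ∀ r, k ≤ r → seqShift (M r) d ∈ B r) r h1 _ => hd r h1
  have hae : ∀ᵐ d ∂iidMeasure ρ, ∀ k ≥ r₀, ¬ ∀ r, k ≤ r → seqShift (M r) d ∈ B r := by
    rw [ae_all_iff]
    intro k
    by_cases hk : k ≥ r₀
    · filter_upwards [measure_eq_zero_iff_ae_notMem.mp (hzero k hk)] with d hd _
      exact hd
    · exact Eventually.of_forall fun d h => absurd h hk
  filter_upwards [hae] with d hd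
  rw [frequently_atTop]
  intro k
  have := hd (max k r₀) (le_max_right _ _)
  push Not at this
  obtain ⟨r, hr, h⟩ := this
  exact ⟨r, (le_max_left _ _).trans hr, by simpa [hB] using h⟩

theorem IsDepthLaw.ae_frequently_le_cutCount (hρ : IsDepthLaw ρ) {ε : ℝ} (hε : 0 < ε)
    (hε' : ε ≤ 1 / 4) :
    ∀ᵐ d ∂iidMeasure ρ, ∃ᶠ m : ℕ in atTop,
      (1 / 4 - ε) * Real.log m ^ 2 ≤ (cutCount d 0 m : ℝ) := by
  obtain ⟨Q, hQ, h⟩ := hρ.half_le_measureReal_maxCutCount (half_pos hε)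
  have hpow2 : Tendsto (fun r : ℕ => 2 ^ r) atTop atTop :=
    tendsto_pow_atTop_atTop_of_one_lt one_lt_two
  obtain ⟨r₀, hr₀⟩ := eventually_atTop.mp (hpow2.eventually h)
  have hlogt : Tendsto (fun r : ℕ => Real.log (((2 ^ r : ℕ) : ℝ) ^ Q)) atTop atTop := by
    have : (fun r : ℕ => Real.log (((2 ^ r : ℕ) : ℝ) ^ Q)) =
        fun r : ℕ => (Q * Real.log 2) * (r : ℝ) := by
      funext r
      push_cast
      rw [Real.log_pow, Real.log_pow]
      ring
    rw [this]
    have hQ' : (0 : ℝ) < Q := by exact_mod_cast hQ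
    exact tendsto_natCast_atTop_atTop.const_mul_atTop
      (mul_pos hQ' (Real.log_pos one_lt_two))
  -- The level found lies in [M, 2 M), so its logarithm exceeds log M by at most log 2, a factor
  -- tending to 1.
  have hlim : Tendsto (fun r : ℕ =>
      (1 / 4 - ε) * (1 + Real.log 2 / Real.log (((2 ^ r : ℕ) : ℝ) ^ Q)) ^ 2) atTop
      (nhds ((1 / 4 - ε) * (1 + 0) ^ 2)) :=
    ((hlogt.const_div_atTop (Real.log 2)).const_add 1 |>.pow 2).const_mul _
  have hev := hlim.eventually_lt_const
    (show (1 / 4 - ε) * (1 + 0) ^ 2 < 1 / 4 - ε / 2 by linarith)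
  filter_upwards [ae_frequently_of_half_le (ρ := ρ) (M := fun r => (2 ^ r) ^ Q)
    (v := fun r => ⌈(1 / 4 - ε / 2) * Real.log (((2 ^ r : ℕ) : ℝ) ^ Q) ^ 2⌉₊) (fun r => by
      rw [pow_succ 2 r, mul_pow, mul_comm]
      exact Nat.mul_le_mul_left _ (Nat.le_self_pow hQ.ne' 2)) r₀ hr₀] with d hd
  rw [frequently_atTop]
  intro m₀
  obtain ⟨r, ⟨⟨hr, hr1⟩, hr2⟩, hr3⟩ := ((hd.and_eventually hev).and_eventually
    (hlogt.eventually_gt_atTop 0) |>.and_eventually (hpow2.eventually_ge_atTop m₀)).exists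
  set M := (2 ^ r) ^ Q with hM
  have hM0 : 0 < M := by positivity
  obtain ⟨m, hm, hmax⟩ := Finset.exists_mem_eq_sup (Finset.range M)
    (Finset.nonempty_range_iff.mpr hM0.ne') (cutCount (seqShift M d) 0)
  have hmM := Finset.mem_range.mp hm
  rw [maxCutCount, hmax, cutCount_seqShift, add_zero] at hr
  refine ⟨M + m, ?_, ?_⟩
  · exact hr3.trans ((Nat.le_self_pow hQ.ne' _).trans (Nat.le_add_right _ _))
  have h1 := (Nat.ceil_le.mp hr).trans
    (Nat.cast_le.mpr (cutCount_anti_left d (M + m) (Nat.zero_le M)))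
  refine le_trans ?_ h1
  have hcast : (((2 ^ r : ℕ) : ℝ) ^ Q) = M := by rw [hM]; push_cast; rfl
  rw [hcast] at hr1 hr2 ⊢
  have hMr : (0 : ℝ) < M := by exact_mod_cast hM0
  have hlog : Real.log ((M + m : ℕ) : ℝ) ≤ Real.log M * (1 + Real.log 2 / Real.log M) := by
    rw [mul_add, mul_one, mul_div_cancel₀ _ hr2.ne', ← Real.log_mul hMr.ne' two_ne_zero]
    have : ((M + m : ℕ) : ℝ) ≤ M * 2 := by exact_mod_cast (by omega : M + m ≤ M * 2)
    exact Real.log_le_log (by positivity) this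
  have hlog0 : 0 ≤ Real.log ((M + m : ℕ) : ℝ) := Real.log_natCast_nonneg _
  calc (1 / 4 - ε) * Real.log ((M + m : ℕ) : ℝ) ^ 2
      ≤ (1 / 4 - ε) * (Real.log M * (1 + Real.log 2 / Real.log M)) ^ 2 := by
        have : 0 ≤ 1 / 4 - ε := by linarith
        gcongr
    _ = (1 / 4 - ε) * (1 + Real.log 2 / Real.log M) ^ 2 * Real.log M ^ 2 := by ring
    _ ≤ (1 / 4 - ε / 2) * Real.log M ^ 2 := by gcongr

end Depth

/-! ### First passages of a nearest-neighbour path -/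

/-- The walk with increments `x`. -/
def walk (x : ℕ → ℤ) (n : ℕ) : ℤ := ∑ i ∈ Finset.range n, x i

/-- All increments are `1` or `-1`. -/
def IsNearestNeighbour (x : ℕ → ℤ) : Prop := ∀ i, x i = 1 ∨ x i = -1

/-- The walk with increments `x` reaches a positive height, `1`, for the first time at time `n`. -/
def IsPassage (x : ℕ → ℤ) (n : ℕ) : Prop := walk x n = 1 ∧ ∀ k < n, walk x k ≤ 0

/-- The time of the first passage to height `1`. -/
noncomputable def passageTime (x : ℕ → ℤ) : ℕ := sInf {n | IsPassage x n}

/-- The increments after the first passage to height `1`. -/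
noncomputable def passageShift (x : ℕ → ℤ) : ℕ → ℤ := seqShift (passageTime x) x

/-- The depth reached before the first passage to height `1`. -/
noncomputable def passageDepth (x : ℕ → ℤ) : ℕ :=
  (Finset.range (passageTime x + 1)).sup fun k => (-walk x k).toNat

@[simp]
theorem walk_zero (x : ℕ → ℤ) : walk x 0 = 0 := by simp [walk]

theorem walk_succ (x : ℕ → ℤ) (n : ℕ) : walk x (n + 1) = walk x n + x n :=
  Finset.sum_range_succ _ _

theorem walk_add (x : ℕ → ℤ) (m n : ℕ) : walk x (m + n) = walk x m + walk (seqShift m x) n :=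
  Finset.sum_range_add _ _ _

theorem walk_congr {x y : ℕ → ℤ} {n : ℕ} (h : ∀ i < n, x i = y i) : walk x n = walk y n :=
  Finset.sum_congr rfl fun i hi => h i (Finset.mem_range.mp hi)

theorem IsNearestNeighbour.seqShift {x : ℕ → ℤ} (hx : IsNearestNeighbour x) (n : ℕ) :
    IsNearestNeighbour (seqShift n x) := fun i => hx (n + i)

theorem isPassage_congr {x y : ℕ → ℤ} {n : ℕ} (h : ∀ i < n, x i = y i) :
    IsPassage x n ↔ IsPassage y n := by
  unfold IsPassage
  rw [walk_congr h]
  refine and_congr_right fun _ => forall_congr' fun k => imp_congr_right fun hk => ?_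
  rw [walk_congr fun i hi => h i (hi.trans hk)]

theorem IsPassage.unique {x : ℕ → ℤ} {m n : ℕ} (hm : IsPassage x m) (hn : IsPassage x n) :
    m = n := by
  rcases lt_trichotomy m n with h | h | h
  · have := hn.2 m h; have := hm.1; omega
  · exact h
  · have := hm.2 n h; have := hn.1; omega

theorem IsPassage.passageTime_eq {x : ℕ → ℤ} {n : ℕ} (h : IsPassage x n) : passageTime x = n :=
  (Nat.sInf_mem (s := {n | IsPassage x n}) ⟨n, h⟩ : IsPassage x _).unique h

theorem isPassage_passageTime {x : ℕ → ℤ} (h : ∃ n, IsPassage x n) :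
    IsPassage x (passageTime x) := Nat.sInf_mem h

theorem passageTime_eq_zero {x : ℕ → ℤ} (h : ¬ ∃ n, IsPassage x n) : passageTime x = 0 := by
  have : {n | IsPassage x n} = ∅ := Set.eq_empty_of_forall_notMem fun n hn => h ⟨n, hn⟩
  rw [passageTime, this, Nat.sInf_empty]

theorem IsPassage.pos {x : ℕ → ℤ} {n : ℕ} (h : IsPassage x n) : 0 < n := by
  rcases Nat.eq_zero_or_pos n with rfl | hn
  · have := h.1; simp at this
  · exact hn

theorem passageDepth_lt_iff {x : ℕ → ℤ} {c : ℕ} (hc : 0 < c) :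
    passageDepth x < c ↔ ∀ k ≤ passageTime x, -(c : ℤ) < walk x k := by
  rw [passageDepth, Finset.sup_lt_iff (by simpa using hc)]
  refine forall_congr' fun k => ?_
  rw [Finset.mem_range, Nat.lt_succ_iff]
  refine imp_congr_right fun _ => ?_
  omega

theorem IsNearestNeighbour.exists_isPassage {x : ℕ → ℤ} (hx : IsNearestNeighbour x) {n : ℕ}
    (hn : 1 ≤ walk x n) : ∃ k ≤ n, IsPassage x k := by
  classical
  have hex : ∃ k, 1 ≤ walk x k := ⟨n, hn⟩
  have hmin : ∀ k < Nat.find hex, walk x k ≤ 0 := fun k hk => by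
    have := Nat.find_min hex hk
    omega
  refine ⟨Nat.find hex, Nat.find_min' hex hn, ?_, hmin⟩
  have h1 := Nat.find_spec hex
  rcases h : Nat.find hex with _ | j
  · rw [h] at h1; simp at h1
  · rw [h, walk_succ] at h1
    have h2 := hmin j (by omega)
    have h3 := hx j
    rw [walk_succ]
    omega

theorem isPassage_one {x : ℕ → ℤ} (h : x 0 = 1) : IsPassage x 1 := by
  refine ⟨by simp [walk, h], fun k hk => ?_⟩
  rw [Nat.lt_one_iff.mp hk, walk_zero]

theorem walk_one_add {x : ℕ → ℤ} (h : x 0 = -1) (k : ℕ) :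
    walk x (1 + k) = -1 + walk (seqShift 1 x) k := by
  rw [walk_add]
  simp [walk, h]

theorem isPassage_one_add_add {x : ℕ → ℤ} (h : x 0 = -1) {a b : ℕ}
    (ha : IsPassage (seqShift 1 x) a) (hb : IsPassage (seqShift a (seqShift 1 x)) b) :
    IsPassage x (1 + (a + b)) := by
  constructor
  · rw [walk_one_add h, walk_add, ha.1, hb.1]
    norm_num
  · intro k hk
    rcases k with _ | k
    · simp
    · rw [add_comm, walk_one_add h]
      rcases lt_or_ge k a with hka | hka
      · have := ha.2 k hka
        omega
      · obtain ⟨j, rfl⟩ := Nat.exists_eq_add_of_le hka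
        have := hb.2 j (by omega)
        rw [walk_add, ha.1]
        omega

/-- After a first step down the walk has to climb two levels, and cannot skip the intermediate one:
a passage is two successive passages. -/
theorem IsNearestNeighbour.exists_isPassage_iff {x : ℕ → ℤ} (hx : IsNearestNeighbour x)
    (h : x 0 = -1) :
    (∃ n, IsPassage x n) ↔ (∃ a, IsPassage (_root_.seqShift 1 x) a) ∧
      ∃ b, IsPassage (passageShift (_root_.seqShift 1 x)) b := by
  constructor
  · rintro ⟨n, hn⟩
    have hn1 : n = 1 + (n - 1) := by have := hn.pos; omega
    have h2 : walk (_root_.seqShift 1 x) (n - 1) = 2 := by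
      have := hn.1
      rw [hn1, walk_one_add h] at this
      omega
    obtain ⟨a, han, ha⟩ := (hx.seqShift 1).exists_isPassage (n := n - 1) (by omega)
    refine ⟨⟨a, ha⟩, ?_⟩
    rw [passageShift, ha.passageTime_eq]
    have h3 := walk_add (_root_.seqShift 1 x) a (n - 1 - a)
    rw [Nat.add_sub_cancel' han, h2, ha.1] at h3
    obtain ⟨b, _, hb⟩ := ((hx.seqShift 1).seqShift a).exists_isPassage (n := n - 1 - a) (by omega)
    exact ⟨b, hb⟩
  · rintro ⟨⟨a, ha⟩, ⟨b, hb⟩⟩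
    rw [passageShift, ha.passageTime_eq] at hb
    exact ⟨_, isPassage_one_add_add h ha hb⟩

theorem passageTime_of_neg {x : ℕ → ℤ} (h : x 0 = -1)
    (ha : ∃ a, IsPassage (seqShift 1 x) a) (hb : ∃ b, IsPassage (passageShift (seqShift 1 x)) b) :
    passageTime x =
      1 + (passageTime (seqShift 1 x) + passageTime (passageShift (seqShift 1 x))) :=
  (isPassage_one_add_add h (isPassage_passageTime ha) (isPassage_passageTime hb)).passageTime_eq

/-- The first of the two passages starts at height -1 and so has one unit less room below; the
second starts at height 0. -/
theorem passageDepth_lt_of_neg {x : ℕ → ℤ} (h : x 0 = -1)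
    (ha : ∃ a, IsPassage (seqShift 1 x) a) (hb : ∃ b, IsPassage (passageShift (seqShift 1 x)) b)
    (c : ℕ) : passageDepth x < c + 1 ↔
      passageDepth (seqShift 1 x) < c ∧ passageDepth (passageShift (seqShift 1 x)) < c + 1 := by
  have hp := passageTime_of_neg h ha hb
  have hpa := isPassage_passageTime ha
  rw [passageDepth_lt_iff c.succ_pos, passageDepth_lt_iff c.succ_pos, hp]
  set y := seqShift 1 x with hy
  have hadd : ∀ j, walk y (passageTime y + j) = 1 + walk (passageShift y) j := fun j => by
    rw [walk_add, hpa.1]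
    rfl
  rcases Nat.eq_zero_or_pos c with rfl | hc
  · simp only [not_lt_zero, false_and, iff_false, not_forall]
    refine ⟨1, by omega, ?_⟩
    have := walk_one_add h 0
    simp at this ⊢
    omega
  rw [passageDepth_lt_iff hc]
  constructor
  · intro H
    constructor
    · intro k hk
      have := H (1 + k) (by omega)
      rw [walk_one_add h, ← hy] at this
      push_cast at this
      omega
    · intro k hk
      have := H (1 + (passageTime y + k)) (by omega)
      rw [walk_one_add h, hadd] at this
      omega
  · rintro ⟨H1, H2⟩ k hk
    rcases k with _ | k
    · simp; omega
    · rw [add_comm k 1, walk_one_add h, ← hy]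
      rcases le_total k (passageTime y) with hka | hka
      · have := H1 k hka
        push_cast
        omega
      · obtain ⟨j, rfl⟩ := Nat.exists_eq_add_of_le hka
        have := H2 j (by omega)
        rw [hadd]
        omega

section Measurability

theorem measurableSet_isPassage (n : ℕ) : MeasurableSet {x | IsPassage x n} :=
  measurableSet_setOfPred.mpr (measurable_of_dependsOn (n := n) fun x y h => by
    simp only [eq_iff_iff]
    exact isPassage_congr fun i hi => h i (Set.mem_Iio.mpr hi))

theorem measurableSet_exists_isPassage : MeasurableSet {x | ∃ n, IsPassage x n} := by
  have : {x | ∃ n, IsPassage x n} = ⋃ n, {x | IsPassage x n} := by ext; simp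
  rw [this]
  exact MeasurableSet.iUnion measurableSet_isPassage

theorem measurable_passageTime : Measurable passageTime := by
  refine measurable_to_countable' fun n => ?_
  have : passageTime ⁻¹' {n} = {x | IsPassage x n} ∪
      ({x | ∃ n, IsPassage x n}ᶜ ∩ {_x | n = 0}) := by
    ext x
    simp only [Set.mem_preimage, Set.mem_singleton_iff, Set.mem_union, Set.mem_inter_iff,
      Set.mem_compl_iff, Set.mem_ofPred_eq]
    by_cases h : ∃ n, IsPassage x n
    · simp only [h, not_true_eq_false, false_and, or_false]
      exact ⟨fun h' => h' ▸ isPassage_passageTime h, fun h' => h'.passageTime_eq⟩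
    · have h' : ¬ IsPassage x n := fun hn => h ⟨n, hn⟩
      simp only [h, h', not_false_eq_true, true_and, false_or, passageTime_eq_zero h, eq_comm]
  rw [this]
  exact (measurableSet_isPassage n).union
    (measurableSet_exists_isPassage.compl.inter (MeasurableSet.const _))

theorem measurable_passageShift : Measurable passageShift := by
  have h : Measurable fun p : ℕ × (ℕ → ℤ) => seqShift p.1 p.2 :=
    measurable_from_prod_countable_right fun n => measurable_seqShift n
  exact h.comp (measurable_passageTime.prodMk measurable_id)

theorem measurable_passageDepth : Measurable passageDepth := by
  have h : Measurable fun p : ℕ × (ℕ → ℤ) =>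
      (Finset.range (p.1 + 1)).sup fun k => (-walk p.2 k).toNat := by
    refine measurable_from_prod_countable_right fun n => ?_
    refine measurable_of_dependsOn (n := n) fun x y hxy => ?_
    refine Finset.sup_congr rfl fun k hk => ?_
    rw [walk_congr fun i hi => hxy i (Set.mem_Iio.mpr (by
      have := Finset.mem_range.mp hk; omega))]
  exact h.comp (measurable_passageTime.prodMk measurable_id)

end Measurability

/-! ### The strong Markov property at the first passage -/

/-- A function of the increments up to the first passage that vanishes if there is no passage. -/
structure IsPassageFun (f : (ℕ → ℤ) → ENNReal) : Prop where
  eq_zero : ∀ x, (¬ ∃ n, IsPassage x n) → f x = 0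
  congr : ∀ x y n, IsPassage x n → (∀ i < n, x i = y i) → f x = f y

theorem IsPassageFun.dependsOn {f : (ℕ → ℤ) → ENNReal} (hf : IsPassageFun f) (n : ℕ) :
    DependsOn ({x | IsPassage x n}.indicator f) (Set.Iio n) := by
  intro x y h
  have h' : ∀ i < n, x i = y i := fun i hi => h i (Set.mem_Iio.mpr hi)
  have := isPassage_congr h'
  by_cases hx : IsPassage x n
  · rw [Set.indicator_of_mem (show x ∈ {x | IsPassage x n} from hx),
      Set.indicator_of_mem (show y ∈ {x | IsPassage x n} from this.mp hx)]
    exact hf.congr x y n hx h'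
  · rw [Set.indicator_of_notMem (show x ∉ {x | IsPassage x n} from hx),
      Set.indicator_of_notMem (show y ∉ {x | IsPassage x n} from fun hy => hx (this.mpr hy))]

theorem IsPassageFun.tsum_indicator {f : (ℕ → ℤ) → ENNReal} (hf : IsPassageFun f) (x : ℕ → ℤ) :
    f x = ∑' n, {x | IsPassage x n}.indicator f x := by
  by_cases h : ∃ n, IsPassage x n
  · obtain ⟨n, hn⟩ := h
    rw [tsum_eq_single n fun m hm => Set.indicator_of_notMem
      (show x ∉ {x | IsPassage x m} from fun hm' => hm (hm'.unique hn)) f]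
    exact (Set.indicator_of_mem (show x ∈ {x | IsPassage x n} from hn) f).symm
  · rw [hf.eq_zero x h]
    refine (ENNReal.tsum_eq_zero.mpr fun n => ?_).symm
    exact Set.indicator_of_notMem (show x ∉ {x | IsPassage x n} from fun hn => h ⟨n, hn⟩) f

theorem IsPassageFun.measurable {f : (ℕ → ℤ) → ENNReal} (hf : IsPassageFun f) : Measurable f := by
  have : f = fun x => ∑' n, {x | IsPassage x n}.indicator f x := funext hf.tsum_indicator
  rw [this]
  exact Measurable.tsum fun n => measurable_of_dependsOn (hf.dependsOn n)

/-- The increments after the first passage are independent of those before, with the same law. -/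
theorem IsPassageFun.lintegral_mul_comp_passageShift {f : (ℕ → ℤ) → ENNReal} (hf : IsPassageFun f)
    (ν : Measure ℤ) [IsProbabilityMeasure ν] {h : (ℕ → ℤ) → ENNReal} (hh : Measurable h) :
    ∫⁻ x, f x * h (passageShift x) ∂iidMeasure ν =
      (∫⁻ x, f x ∂iidMeasure ν) * ∫⁻ x, h x ∂iidMeasure ν := by
  have hm : ∀ n, Measurable ({x | IsPassage x n}.indicator f) := fun n =>
    measurable_of_dependsOn (hf.dependsOn n)
  have h1 : ∀ x, f x * h (passageShift x) =
      ∑' n, {x | IsPassage x n}.indicator f x * h (seqShift n x) := fun x => by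
    rw [hf.tsum_indicator x, ← ENNReal.tsum_mul_right]
    refine tsum_congr fun n => ?_
    by_cases hx : IsPassage x n
    · rw [passageShift, hx.passageTime_eq]
    · rw [Set.indicator_of_notMem (show x ∉ {x | IsPassage x n} from hx), zero_mul, zero_mul]
  have h2 : ∀ x, f x = ∑' n, {x | IsPassage x n}.indicator f x := hf.tsum_indicator
  have hm2 : ∀ n, Measurable fun x => {x | IsPassage x n}.indicator f x * h (seqShift n x) :=
    fun n => (hm n).mul (hh.comp (measurable_seqShift n))
  rw [lintegral_congr h1, lintegral_congr h2, lintegral_tsum fun n => (hm2 n).aemeasurable,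
    lintegral_tsum fun n => (hm n).aemeasurable, ← ENNReal.tsum_mul_right]
  exact tsum_congr fun n => lintegral_mul_comp_seqShift ν (hm n) (hf.dependsOn n) hh

/-! ### First-step analysis and the law of the depths -/

/-- The uniform distribution on `{1, -1}`. -/
noncomputable def stepLaw : Measure ℤ :=
  (1 / 2 : ENNReal) • Measure.dirac 1 + (1 / 2 : ENNReal) • Measure.dirac (-1)

theorem stepLaw_apply (s : Set ℤ) :
    stepLaw s = 1 / 2 * s.indicator 1 1 + 1 / 2 * s.indicator 1 (-1) := by
  simp [stepLaw]

instance isProbabilityMeasure_stepLaw : IsProbabilityMeasure stepLaw := by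
  constructor
  simp [stepLaw_apply, ENNReal.inv_two_add_inv_two]

theorem measure_apply_zero_eq (a : ℤ) (ha : a = 1 ∨ a = -1) :
    iidMeasure stepLaw {x | x 0 = a} = 1 / 2 := by
  have h := (measurePreserving_eval_infinitePi (fun _ : ℕ => stepLaw) 0).measure_preimage
    (measurableSet_singleton a).nullMeasurableSet
  have h2 : (fun x : ℕ → ℤ => x 0) ⁻¹' ({a} : Set ℤ) = {x : ℕ → ℤ | x 0 = a} := rfl
  change iidMeasure stepLaw ((fun x : ℕ → ℤ => x 0) ⁻¹' ({a} : Set ℤ)) = stepLaw {a} at h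
  rw [← h2, h, stepLaw_apply]
  rcases ha with rfl | rfl <;> simp

theorem ae_isNearestNeighbour : ∀ᵐ x ∂iidMeasure stepLaw, IsNearestNeighbour x := by
  refine ae_all_iff.mpr fun i => ?_
  have h : ∀ᵐ a ∂stepLaw, a = 1 ∨ a = -1 := by
    rw [ae_iff, stepLaw_apply]
    simp
  exact (measurePreserving_eval_infinitePi (fun _ : ℕ => stepLaw) i).quasiMeasurePreserving.ae h

theorem lintegral_first_step {g F : (ℕ → ℤ) → ENNReal} (hF : Measurable F) {c : ENNReal}
    (h1 : ∀ x, IsNearestNeighbour x → x 0 = 1 → g x = c)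
    (h2 : ∀ x, IsNearestNeighbour x → x 0 = -1 → g x = F (seqShift 1 x)) :
    ∫⁻ x, g x ∂iidMeasure stepLaw = c / 2 + (∫⁻ x, F x ∂iidMeasure stepLaw) / 2 := by
  have hdep : ∀ a : ℤ, DependsOn ({x : ℕ → ℤ | x 0 = a}.indicator (1 : (ℕ → ℤ) → ENNReal))
      (Set.Iio 1) := fun a x y h => by
    have h0 := h 0 (Set.mem_Iio.mpr one_pos)
    simp [Set.indicator_apply, h0]
  have hm : ∀ a : ℤ, Measurable ({x : ℕ → ℤ | x 0 = a}.indicator (1 : (ℕ → ℤ) → ENNReal)) :=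
    fun a => measurable_of_dependsOn (hdep a)
  have hms : ∀ a : ℤ, MeasurableSet {x : ℕ → ℤ | x 0 = a} := fun a =>
    measurableSet_eq_fun (measurable_pi_apply 0) measurable_const
  have hg : g =ᵐ[iidMeasure stepLaw] fun x =>
      c * {x : ℕ → ℤ | x 0 = 1}.indicator 1 x +
        {x : ℕ → ℤ | x 0 = -1}.indicator 1 x * F (seqShift 1 x) := by
    filter_upwards [ae_isNearestNeighbour] with x hx
    rcases hx 0 with h | h
    · simp [h1 x hx h, h]
    · simp [h2 x hx h, h]
  rw [lintegral_congr_ae hg, lintegral_add_left ((hm 1).const_mul c), lintegral_const_mul _ (hm 1),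
    lintegral_mul_comp_seqShift _ (hm (-1)) (hdep (-1)) hF, lintegral_indicator_one (hms 1),
    lintegral_indicator_one (hms (-1)), measure_apply_zero_eq 1 (Or.inl rfl),
    measure_apply_zero_eq (-1) (Or.inr rfl)]
  rw [mul_comm (1 / 2 : ENNReal), mul_one_div, mul_one_div]

open Classical in
/-- A weight depending on the time and the depth of the first passage. -/
noncomputable def passageWeight (w : ℕ → ℕ → ENNReal) (x : ℕ → ℤ) : ENNReal :=
  if ∃ n, IsPassage x n then w (passageTime x) (passageDepth x) else 0

theorem isPassageFun_passageWeight (w : ℕ → ℕ → ENNReal) : IsPassageFun (passageWeight w) := by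
  refine ⟨fun x h => if_neg h, fun x y n hx h => ?_⟩
  have hy := (isPassage_congr h).mp hx
  have hd : passageDepth x = passageDepth y := by
    unfold passageDepth
    rw [hx.passageTime_eq, hy.passageTime_eq]
    refine Finset.sup_congr rfl fun k hk => ?_
    rw [walk_congr fun i hi => h i (by have := Finset.mem_range.mp hk; omega)]
  rw [passageWeight, passageWeight, if_pos ⟨n, hx⟩, if_pos ⟨n, hy⟩, hd, hx.passageTime_eq,
    hy.passageTime_eq]

/-- The common form of the first-step equations for time and depth: a step up ends the passage at
time 1 and depth 0, and a step down leaves two independent passages, over which the weight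
factorises. -/
theorem lintegral_passageWeight {w₁ w₂ w : ℕ → ℕ → ENNReal} {c : ENNReal} {z : ENNReal}
    (h1 : w 1 0 = c) (h2 : ∀ x, x 0 = -1 → (∃ a, IsPassage (seqShift 1 x) a) →
      (∃ b, IsPassage (passageShift (seqShift 1 x)) b) →
      w (passageTime x) (passageDepth x) =
        z * (w₁ (passageTime (seqShift 1 x)) (passageDepth (seqShift 1 x)) *
          w₂ (passageTime (passageShift (seqShift 1 x)))
            (passageDepth (passageShift (seqShift 1 x))))) :
    ∫⁻ x, passageWeight w x ∂iidMeasure stepLaw =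
      c / 2 + z * ((∫⁻ x, passageWeight w₁ x ∂iidMeasure stepLaw) *
        ∫⁻ x, passageWeight w₂ x ∂iidMeasure stepLaw) / 2 := by
  have hm : Measurable fun y => passageWeight w₁ y * passageWeight w₂ (passageShift y) :=
    (isPassageFun_passageWeight w₁).measurable.mul
      ((isPassageFun_passageWeight w₂).measurable.comp measurable_passageShift)
  rw [lintegral_first_step (F := fun y => z * (passageWeight w₁ y *
    passageWeight w₂ (passageShift y))) (hm.const_mul z) (c := c),
    lintegral_const_mul _ hm,
    (isPassageFun_passageWeight w₁).lintegral_mul_comp_passageShift stepLaw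
      (isPassageFun_passageWeight w₂).measurable]
  · intro x _ h
    have hp := isPassage_one h
    have hd : passageDepth x = 0 := by
      have : passageDepth x < 1 := by
        rw [passageDepth_lt_iff one_pos, hp.passageTime_eq]
        intro k hk
        interval_cases k
        · simp
        · simp [walk, h]
      omega
    rw [passageWeight, if_pos ⟨1, hp⟩, hp.passageTime_eq, hd, h1]
  · intro x hx h
    have hiff := hx.exists_isPassage_iff h
    by_cases ha : ∃ a, IsPassage (seqShift 1 x) a
    · by_cases hb : ∃ b, IsPassage (passageShift (seqShift 1 x)) b
      · simp only [passageWeight, if_pos ha, if_pos hb, if_pos (hiff.mpr ⟨ha, hb⟩)]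
        exact h2 x h ha hb
      · simp only [passageWeight, if_neg hb, if_neg fun H => hb (hiff.mp H).2, mul_zero]
    · simp only [passageWeight, if_neg ha, if_neg fun H => ha (hiff.mp H).1, zero_mul, mul_zero]

/-- The generating function of the first passage time. -/
noncomputable def passageGen (z : ENNReal) : ENNReal :=
  ∫⁻ x, passageWeight (fun t _ => z ^ t) x ∂iidMeasure stepLaw

theorem passageGen_eq (z : ENNReal) : passageGen z = z / 2 + z * (passageGen z * passageGen z) / 2 :=
  lintegral_passageWeight (pow_one z) fun x h ha hb => by
    simp only [passageTime_of_neg h ha hb, pow_add, pow_one]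

theorem passageGen_le_one {z : ENNReal} (hz : z ≤ 1) : passageGen z ≤ 1 := by
  refine (lintegral_mono (g := fun _ => 1) fun x => ?_).trans (by simp)
  unfold passageWeight
  split_ifs
  · exact pow_le_one₀ zero_le hz
  · exact zero_le_one

theorem toReal_passageGen_eq {z : ENNReal} (hz : z ≤ 1) :
    (passageGen z).toReal = z.toReal * (1 + (passageGen z).toReal ^ 2) / 2 := by
  have hzt : z ≠ ⊤ := ne_top_of_le_ne_top ENNReal.one_ne_top hz
  have hpt : passageGen z ≠ ⊤ := ne_top_of_le_ne_top ENNReal.one_ne_top (passageGen_le_one hz)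
  have h := congrArg ENNReal.toReal (passageGen_eq z)
  rw [ENNReal.toReal_add (ENNReal.div_ne_top hzt two_ne_zero)
    (ENNReal.div_ne_top (ENNReal.mul_ne_top hzt (ENNReal.mul_ne_top hpt hpt)) two_ne_zero)] at h
  simp only [ENNReal.toReal_div, ENNReal.toReal_mul, ENNReal.toReal_ofNat] at h
  linarith

/-- At z = 1 the quadratic equation for the generating function is (φ - 1)² = 0. -/
theorem measure_exists_isPassage :
    iidMeasure stepLaw {x | ∃ n, IsPassage x n} = 1 := by
  have h0 : passageGen 1 = iidMeasure stepLaw {x | ∃ n, IsPassage x n} := by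
    rw [← lintegral_indicator_one measurableSet_exists_isPassage]
    refine lintegral_congr fun x => ?_
    by_cases hx : ∃ n, IsPassage x n
    · rw [Set.indicator_of_mem (show x ∈ {x | ∃ n, IsPassage x n} from hx), passageWeight,
        if_pos hx, one_pow, Pi.one_apply]
    · rw [Set.indicator_of_notMem (show x ∉ {x | ∃ n, IsPassage x n} from hx), passageWeight,
        if_neg hx]
  have h := toReal_passageGen_eq (z := 1) le_rfl
  have h1 : (passageGen 1).toReal = 1 := by
    rw [ENNReal.toReal_one] at h
    nlinarith [sq_nonneg ((passageGen 1).toReal - 1)]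
  rw [← h0, ← ENNReal.toReal_eq_one_iff, h1]

theorem ae_exists_isPassage : ∀ᵐ x ∂iidMeasure stepLaw, ∃ n, IsPassage x n := by
  have := (prob_compl_eq_zero_iff measurableSet_exists_isPassage).mpr measure_exists_isPassage
  rw [ae_iff]
  exact this

theorem lintegral_comp_passageTime_depth_mul {w : ℕ → ℕ → ENNReal} {h : (ℕ → ℤ) → ENNReal}
    (hh : Measurable h) :
    ∫⁻ x, w (passageTime x) (passageDepth x) * h (passageShift x) ∂iidMeasure stepLaw =
      (∫⁻ x, w (passageTime x) (passageDepth x) ∂iidMeasure stepLaw) *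
        ∫⁻ x, h x ∂iidMeasure stepLaw := by
  have he : ∀ᵐ x ∂iidMeasure stepLaw,
      passageWeight w x = w (passageTime x) (passageDepth x) := by
    filter_upwards [ae_exists_isPassage] with x hx
    rw [passageWeight, if_pos hx]
  rw [← lintegral_congr_ae he, ← (isPassageFun_passageWeight w).lintegral_mul_comp_passageShift
    stepLaw hh]
  refine lintegral_congr_ae ?_
  filter_upwards [he] with x hx
  rw [hx]

theorem measurePreserving_passageShift :
    MeasurePreserving passageShift (iidMeasure stepLaw) (iidMeasure stepLaw) := by
  refine ⟨measurable_passageShift, ?_⟩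
  ext s hs
  have h := lintegral_comp_passageTime_depth_mul (w := fun _ _ => 1)
    (h := s.indicator 1) (measurable_one.indicator hs)
  simp only [one_mul, lintegral_one, measure_univ, lintegral_indicator_one hs] at h
  rw [Measure.map_apply measurable_passageShift hs, ← h,
    ← lintegral_indicator_one (measurable_passageShift hs)]
  rfl

/-- The law of the depth of the first passage. -/
noncomputable def depthLaw : Measure ℕ := (iidMeasure stepLaw).map passageDepth

instance isProbabilityMeasure_depthLaw : IsProbabilityMeasure depthLaw :=
  Measure.isProbabilityMeasure_map measurable_passageDepth.aemeasurable

/-- With F(c) = P(depth < c), first-step analysis gives F(c + 1) = 1/2 + F(c) F(c + 1) / 2, solved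
from F(0) = 0 by c / (c + 1). -/
theorem isDepthLaw_depthLaw : IsDepthLaw depthLaw := by
  classical
  intro c
  have hW : ∀ c, depthLaw (Set.Iio c) =
      ∫⁻ x, passageWeight (fun _ k => if k < c then 1 else 0) x ∂iidMeasure stepLaw := fun c => by
    rw [depthLaw, Measure.map_apply measurable_passageDepth measurableSet_Iio,
      ← lintegral_indicator_one (measurable_passageDepth measurableSet_Iio)]
    refine lintegral_congr_ae ?_
    filter_upwards [ae_exists_isPassage] with x hx
    rw [passageWeight, if_pos hx]
    simp [Set.indicator_apply]
  have hrec : ∀ c, depthLaw (Set.Iio (c + 1)) =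
      1 / 2 + 1 * (depthLaw (Set.Iio c) * depthLaw (Set.Iio (c + 1))) / 2 := fun c => by
    rw [hW c, hW (c + 1)]
    refine lintegral_passageWeight (by simp) fun x h ha hb => ?_
    have := passageDepth_lt_of_neg h ha hb c
    by_cases h1 : passageDepth (seqShift 1 x) < c <;>
      by_cases h2 : passageDepth (passageShift (seqShift 1 x)) < c + 1 <;>
      simp [this, h1, h2]
  induction c with
  | zero => simp
  | succ c ih =>
    have h := congrArg ENNReal.toReal (hrec c)
    rw [one_mul, ENNReal.toReal_add (by simp) (ENNReal.div_ne_top (ENNReal.mul_ne_top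
      (measure_ne_top _ _) (measure_ne_top _ _)) two_ne_zero)] at h
    simp only [ENNReal.toReal_div, ENNReal.toReal_mul, ENNReal.toReal_ofNat,
      ENNReal.toReal_one] at h
    change depthLaw.real _ = 1 / 2 + depthLaw.real _ * depthLaw.real _ / 2 at h
    rw [ih] at h
    push_cast
    field_simp at h ⊢
    linarith

/-- The depths of the successive first passages to new heights. -/
noncomputable def depthSeq (x : ℕ → ℤ) (m : ℕ) : ℕ := passageDepth (passageShift^[m] x)

theorem measurable_depthSeq : Measurable depthSeq :=
  measurable_pi_lambda _ fun m => measurable_passageDepth.comp (measurable_passageShift.iterate m)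

/-- The strong Markov property splits off one passage at a time; the remaining depths are those of
the shifted path. -/
theorem measure_forall_depthSeq_mem (N : ℕ) (t : ℕ → Set ℕ) :
    iidMeasure stepLaw {x | ∀ i < N, depthSeq x i ∈ t i} =
      ∏ i ∈ Finset.range N, depthLaw (t i) := by
  induction N generalizing t with
  | zero => simp
  | succ N ih =>
    have hm : MeasurableSet {x | ∀ i < N, depthSeq x i ∈ t (i + 1)} := by
      have : {x | ∀ i < N, depthSeq x i ∈ t (i + 1)} =
          ⋂ i ∈ Finset.range N, (fun x => depthSeq x i) ⁻¹' t (i + 1) := by ext; simp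
      rw [this]
      exact Finset.measurableSet_biInter _ fun i _ =>
        ((measurable_pi_apply i).comp measurable_depthSeq) .of_discrete
    have hset : ∀ x, {x | ∀ i < N + 1, depthSeq x i ∈ t i}.indicator (1 : (ℕ → ℤ) → ENNReal) x =
        (t 0).indicator 1 (passageDepth x) *
          {x | ∀ i < N, depthSeq x i ∈ t (i + 1)}.indicator 1 (passageShift x) := fun x => by
      have h0 : ∀ x, (∀ i < N + 1, depthSeq x i ∈ t i) ↔ passageDepth x ∈ t 0 ∧
          ∀ i < N, depthSeq (passageShift x) i ∈ t (i + 1) := by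
        intro x
        constructor
        · exact fun H => ⟨H 0 (by omega), fun i hi => H (i + 1) (by omega)⟩
        · rintro ⟨H0, H⟩ i hi
          rcases i with _ | i
          · exact H0
          · exact H i (by omega)
      have h1 : {x | ∀ i < N + 1, depthSeq x i ∈ t i} = passageDepth ⁻¹' t 0 ∩
          passageShift ⁻¹' {x | ∀ i < N, depthSeq x i ∈ t (i + 1)} := by
        ext x
        exact h0 x
      rw [h1, Set.inter_indicator_one]
      rfl
    have hm' : MeasurableSet {x | ∀ i < N + 1, depthSeq x i ∈ t i} := by
      have : {x | ∀ i < N + 1, depthSeq x i ∈ t i} =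
          ⋂ i ∈ Finset.range (N + 1), (fun x => depthSeq x i) ⁻¹' t i := by ext; simp
      rw [this]
      exact Finset.measurableSet_biInter _ fun i _ =>
        ((measurable_pi_apply i).comp measurable_depthSeq) .of_discrete
    rw [← lintegral_indicator_one hm', lintegral_congr hset,
      lintegral_comp_passageTime_depth_mul (w := fun _ k => (t 0).indicator 1 k)
        (measurable_one.indicator hm),
      lintegral_indicator_one hm, ih fun i => t (i + 1), Finset.prod_range_succ', mul_comm]
    congr 1
    rw [depthLaw, Measure.map_apply measurable_passageDepth .of_discrete,
      ← lintegral_indicator_one (measurable_passageDepth .of_discrete)]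
    rfl

theorem map_depthSeq : (iidMeasure stepLaw).map depthSeq = iidMeasure depthLaw := by
  classical
  refine Measure.eq_infinitePi _ fun s t ht => ?_
  rw [Measure.map_apply measurable_depthSeq (MeasurableSet.pi s.countable_toSet fun i _ => ht i)]
  obtain ⟨N, hN⟩ := s.bddAbove
  have h := measure_forall_depthSeq_mem (N + 1) fun i => if i ∈ s then t i else Set.univ
  have hset : {x | ∀ i < N + 1, depthSeq x i ∈ (if i ∈ s then t i else Set.univ)} =
      depthSeq ⁻¹' (Set.pi s t) := by
    ext x
    simp only [Set.mem_ofPred_eq, Set.mem_preimage, Set.mem_pi, Finset.mem_coe]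
    constructor
    · intro H i hi
      have := H i (Nat.lt_succ_of_le (hN hi))
      rwa [if_pos hi] at this
    · intro H i _
      split_ifs with hi
      · exact H i hi
      · trivial
  rw [hset] at h
  rw [h, ← Finset.prod_subset (s₁ := s)]
  · exact Finset.prod_congr rfl fun i hi => by rw [if_pos hi]
  · exact fun i hi => Finset.mem_range.mpr (Nat.lt_succ_of_le (hN hi))
  · intro i _ hi
    rw [if_neg hi, measure_univ]

/-! ### The growth of the passage times -/

/-- The time at which the walk with increments `x` reaches the level `m`. -/
noncomputable def levelTime (x : ℕ → ℤ) (m : ℕ) : ℕ :=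
  ∑ i ∈ Finset.range m, passageTime (passageShift^[i] x)

theorem levelTime_succ (x : ℕ → ℤ) (m : ℕ) :
    levelTime x (m + 1) = levelTime x m + passageTime (passageShift^[m] x) :=
  Finset.sum_range_succ _ _

theorem levelTime_succ' (x : ℕ → ℤ) (m : ℕ) :
    levelTime x (m + 1) = passageTime x + levelTime (passageShift x) m := by
  rw [levelTime, Finset.sum_range_succ', add_comm]
  rfl

theorem iterate_passageShift (x : ℕ → ℤ) (m : ℕ) :
    passageShift^[m] x = seqShift (levelTime x m) x := by
  induction m with
  | zero => funext i; simp [levelTime, seqShift]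
  | succ m ih =>
    rw [Function.iterate_succ_apply', levelTime_succ, passageShift]
    conv_lhs => rw [ih]
    rw [seqShift_seqShift, ih]

theorem levelTime_mono (x : ℕ → ℤ) : Monotone (levelTime x) :=
  monotone_nat_of_le_succ fun m => by rw [levelTime_succ]; exact Nat.le_add_right _ _

theorem measurable_levelTime (m : ℕ) : Measurable fun x => levelTime x m :=
  Finset.measurable_sum _ fun i _ => measurable_passageTime.comp (measurable_passageShift.iterate i)

theorem lintegral_pow_levelTime (z : ENNReal) (m : ℕ) :
    ∫⁻ x, z ^ levelTime x m ∂iidMeasure stepLaw = passageGen z ^ m := by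
  induction m with
  | zero => simp [levelTime]
  | succ m ih =>
    have hm : Measurable fun x => z ^ levelTime x m :=
      (measurable_of_countable fun n : ℕ => z ^ n).comp (measurable_levelTime m)
    have h1 : ∫⁻ x, z ^ passageTime x ∂iidMeasure stepLaw = passageGen z := by
      refine lintegral_congr_ae ?_
      filter_upwards [ae_exists_isPassage] with x hx
      rw [passageWeight, if_pos hx]
    have h2 := lintegral_comp_passageTime_depth_mul (w := fun t _ => z ^ t) hm
    rw [h1, ih] at h2
    rw [pow_succ', ← h2]
    simp only [levelTime_succ', pow_add]

/-- The generating function of the first passage time at `n / (n + 1)`. -/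
noncomputable def passageGenAt (n : ℕ) : ℝ := (passageGen (ENNReal.ofReal (n / (n + 1)))).toReal

theorem ofReal_div_le_one (n : ℕ) : ENNReal.ofReal ((n : ℝ) / (n + 1)) ≤ 1 :=
  ENNReal.ofReal_le_one.mpr ((div_le_one (by positivity)).mpr (by linarith))

theorem passageGenAt_nonneg (n : ℕ) : 0 ≤ passageGenAt n := ENNReal.toReal_nonneg

theorem passageGenAt_le_one (n : ℕ) : passageGenAt n ≤ 1 := by
  have := ENNReal.toReal_mono ENNReal.one_ne_top (passageGen_le_one (ofReal_div_le_one n))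
  rwa [ENNReal.toReal_one] at this

/-- At z = n / (n + 1) the quadratic equation takes this form, so 1 - φ has order n^(-1/2). This
makes m² the order of the time to reach the level m. -/
theorem passageGenAt_eq {n : ℕ} : n * (1 - passageGenAt n) ^ 2 = 2 * passageGenAt n := by
  have h := toReal_passageGen_eq (ofReal_div_le_one n)
  rw [ENNReal.toReal_ofReal (by positivity)] at h
  change passageGenAt n = _ * (1 + passageGenAt n ^ 2) / 2 at h
  field_simp at h
  linarith

theorem integral_levelTime_eq (n m : ℕ) :
    (∫⁻ x, ENNReal.ofReal ((n : ℝ) / (n + 1)) ^ levelTime x m ∂iidMeasure stepLaw).toReal =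
      passageGenAt n ^ m := by
  rw [lintegral_pow_levelTime, ENNReal.toReal_pow]
  rfl

/-- As z^n ≤ 1/2, the transform φ^m of the passage time is at most 1 - P/2, where P is the
probability to be bounded; Bernoulli's inequality gives φ^m ≥ 1 - m (1 - φ). -/
theorem measureReal_lt_levelTime_le {n : ℕ} (hn : 0 < n) (m : ℕ) :
    (iidMeasure stepLaw).real {x | n < levelTime x m} ≤ 2 * m * √(2 / n) := by
  have hn' : (1 : ℝ) ≤ n := by exact_mod_cast hn
  set φ := passageGenAt n
  have hφ0 : 0 ≤ φ := passageGenAt_nonneg n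
  have hφ1 : φ ≤ 1 := passageGenAt_le_one n
  have hφ : n * (1 - φ) ^ 2 = 2 * φ := passageGenAt_eq
  have hz : (n : ℝ) / (n + 1) ≤ 1 := (div_le_one (by positivity)).mpr (by linarith)
  have hzn : ((n : ℝ) / (n + 1)) ^ n ≤ 1 / 2 := by
    have h1 := one_add_mul_le_pow (a := 1 / (n : ℝ)) (by
      have : 0 ≤ 1 / (n : ℝ) := by positivity
      linarith) n
    rw [mul_one_div_cancel (by positivity)] at h1
    have h2 : (n : ℝ) / (n + 1) = (1 + 1 / (n : ℝ))⁻¹ := by field_simp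
    rw [h2, inv_pow, show (1 : ℝ) / 2 = 2⁻¹ by norm_num]
    exact inv_anti₀ two_pos (by linarith)
  have hmT : MeasurableSet {x | n < levelTime x m} := (measurable_levelTime m) measurableSet_Ioi
  have hle : ∫⁻ x, ENNReal.ofReal ((n : ℝ) / (n + 1)) ^ levelTime x m ∂iidMeasure stepLaw ≤
      iidMeasure stepLaw {x | n < levelTime x m}ᶜ +
        ENNReal.ofReal (1 / 2) * iidMeasure stepLaw {x | n < levelTime x m} := by
    rw [← lintegral_indicator_one hmT, ← lintegral_indicator_one hmT.compl,
      ← lintegral_const_mul _ (measurable_one.indicator hmT),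
      ← lintegral_add_left (measurable_one.indicator hmT.compl)]
    refine lintegral_mono fun x => ?_
    rw [← ENNReal.ofReal_pow (by positivity)]
    by_cases hx : n < levelTime x m
    · rw [Set.indicator_of_notMem (by simpa using hx),
        Set.indicator_of_mem (show x ∈ {x | n < levelTime x m} from hx), zero_add, Pi.one_apply,
        mul_one]
      exact ENNReal.ofReal_le_ofReal
        ((pow_le_pow_of_le_one (by positivity) hz hx.le).trans hzn)
    · rw [Set.indicator_of_mem (by simpa using hx),
        Set.indicator_of_notMem (show x ∉ {x | n < levelTime x m} from hx), mul_zero, add_zero,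
        Pi.one_apply]
      exact ENNReal.ofReal_le_one.mpr (pow_le_one₀ (by positivity) hz)
  have hle' := ENNReal.toReal_mono (by finiteness) hle
  rw [integral_levelTime_eq, ENNReal.toReal_add (by finiteness) (by finiteness),
    ENNReal.toReal_mul, ENNReal.toReal_ofReal (by norm_num)] at hle'
  change φ ^ m ≤ (iidMeasure stepLaw).real {x | n < levelTime x m}ᶜ +
    1 / 2 * (iidMeasure stepLaw).real {x | n < levelTime x m} at hle'
  rw [probReal_compl_eq_one_sub hmT] at hle'
  have hB := one_add_mul_le_pow (a := φ - 1) (by linarith) m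
  rw [add_sub_cancel] at hB
  have h1 : 1 - φ ≤ √(2 / n) := by
    refine Real.le_sqrt_of_sq_le ?_
    rw [le_div_iff₀' (by positivity), hφ]
    linarith
  have h2 : m * (1 - φ) ≤ m * √(2 / n) := by gcongr
  linarith

/-- Markov's inequality for the transform, with z^n ≥ 1/3 and φ^m ≤ exp (-m (1 - φ)) ≤ 1 / (m (1 -
φ)). -/
theorem measureReal_levelTime_le_le {n m : ℕ} (hn : 0 < n) (hm : 0 < m) :
    (iidMeasure stepLaw).real {x | levelTime x m ≤ n} ≤ 3 * (√(2 * n) / m) := by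
  have hn' : (1 : ℝ) ≤ n := by exact_mod_cast hn
  have hm' : (0 : ℝ) < m := by exact_mod_cast hm
  set φ := passageGenAt n
  have hφ0 : 0 ≤ φ := passageGenAt_nonneg n
  have hφ1 : φ ≤ 1 := passageGenAt_le_one n
  have hφ : n * (1 - φ) ^ 2 = 2 * φ := passageGenAt_eq
  -- This turns n (1 - φ)² = 2 φ into the lower bound 1 - φ ≥ 1 / √(2 n).
  have hφ4 : 1 / 4 ≤ φ := by nlinarith [sq_nonneg (1 - φ)]
  have hz : (n : ℝ) / (n + 1) ≤ 1 := (div_le_one (by positivity)).mpr (by linarith)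
  have hzn : 1 / 3 ≤ ((n : ℝ) / (n + 1)) ^ n := by
    have h2 : (n : ℝ) / (n + 1) = (1 + 1 / (n : ℝ))⁻¹ := by field_simp
    have h1 : (1 + 1 / (n : ℝ)) ^ n ≤ 3 := by
      calc (1 + 1 / (n : ℝ)) ^ n ≤ Real.exp (1 / n) ^ n := by
            have := Real.add_one_le_exp (1 / (n : ℝ))
            gcongr
            linarith
        _ = Real.exp 1 := by rw [← Real.exp_nat_mul, mul_one_div_cancel (by positivity)]
        _ ≤ 3 := by linarith [Real.exp_one_lt_d9]
    rw [h2, inv_pow, one_div]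
    exact inv_anti₀ (by positivity) h1
  have hmT : MeasurableSet {x | levelTime x m ≤ n} := (measurable_levelTime m) measurableSet_Iic
  have hle : ENNReal.ofReal (1 / 3) * iidMeasure stepLaw {x | levelTime x m ≤ n} ≤
      ∫⁻ x, ENNReal.ofReal ((n : ℝ) / (n + 1)) ^ levelTime x m ∂iidMeasure stepLaw := by
    rw [← lintegral_indicator_one hmT, ← lintegral_const_mul _ (measurable_one.indicator hmT)]
    refine lintegral_mono fun x => ?_
    by_cases hx : levelTime x m ≤ n
    · rw [Set.indicator_of_mem (show x ∈ {x | levelTime x m ≤ n} from hx), Pi.one_apply, mul_one,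
        ← ENNReal.ofReal_pow (by positivity)]
      exact ENNReal.ofReal_le_ofReal (hzn.trans (pow_le_pow_of_le_one (by positivity) hz hx))
    · rw [Set.indicator_of_notMem (show x ∉ {x | levelTime x m ≤ n} from hx), mul_zero]
      exact zero_le
  have hfin : ∫⁻ x, ENNReal.ofReal ((n : ℝ) / (n + 1)) ^ levelTime x m ∂iidMeasure stepLaw ≠ ⊤ := by
    rw [lintegral_pow_levelTime]
    exact ENNReal.pow_ne_top
      (ne_top_of_le_ne_top ENNReal.one_ne_top (passageGen_le_one (ofReal_div_le_one n)))
  have hle' := ENNReal.toReal_mono hfin hle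
  rw [integral_levelTime_eq, ENNReal.toReal_mul, ENNReal.toReal_ofReal (by norm_num)] at hle'
  change 1 / 3 * (iidMeasure stepLaw).real {x | levelTime x m ≤ n} ≤ φ ^ m at hle'
  have hs0 : 0 < √(2 * (n : ℝ)) := by positivity
  have h1 : 1 / √(2 * n) ≤ 1 - φ := by
    rw [div_le_iff₀ hs0]
    refine le_of_sq_le_sq ?_ (mul_nonneg (by linarith) hs0.le)
    rw [mul_pow, Real.sq_sqrt (by positivity)]
    nlinarith
  have h2 : φ ^ m ≤ √(2 * n) / m := by
    calc φ ^ m ≤ Real.exp (-(1 - φ)) ^ m := by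
          have := Real.one_sub_le_exp_neg (1 - φ)
          gcongr
          linarith
      _ = (Real.exp (m * (1 - φ)))⁻¹ := by
          rw [← Real.exp_nat_mul, ← Real.exp_neg]; congr 1; ring
      _ ≤ (m * (1 / √(2 * n)))⁻¹ := by
          refine inv_anti₀ (by positivity) ?_
          have h3 := Real.add_one_le_exp (m * (1 - φ))
          have h4 : m * (1 / √(2 * n)) ≤ m * (1 - φ) := by gcongr
          linarith
      _ = √(2 * n) / m := by field_simp
  linarith

theorem ae_eventually_levelTime_two_pow {q : ℝ} (hq : 1 / 2 ≤ q) (hq1 : q < 1) :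
    ∀ᵐ x ∂iidMeasure stepLaw, ∀ᶠ r : ℕ in atTop,
      (4 * q ^ 2) ^ r ≤ levelTime x (2 ^ r) ∧ (levelTime x (2 ^ r) : ℝ) ≤ (4 / q ^ 2) ^ r := by
  have hq0 : 0 < q := by linarith
  have h4q : 1 ≤ 4 * q ^ 2 := by nlinarith
  have h4q' : 1 ≤ 4 / q ^ 2 := by
    rw [one_le_div (by positivity)]; nlinarith
  have hgeo : Summable fun r : ℕ => q ^ r := summable_geometric_of_lt_one hq0.le hq1
  have hlow : ∀ r : ℕ, iidMeasure stepLaw {x | levelTime x (2 ^ r) ≤ ⌊(4 * q ^ 2) ^ r⌋₊} ≤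
      ENNReal.ofReal (3 * √2 * q ^ r) := fun r => by
    rw [← ofReal_measureReal]
    refine ENNReal.ofReal_le_ofReal ((measureReal_levelTime_le_le
      (Nat.floor_pos.mpr (one_le_pow₀ h4q)) (by positivity)).trans ?_)
    rw [mul_assoc]
    refine mul_le_mul_of_nonneg_left ?_ (by norm_num)
    rw [div_le_iff₀ (by positivity)]
    push_cast
    calc √(2 * (⌊(4 * q ^ 2) ^ r⌋₊ : ℝ)) ≤ √(2 * (2 ^ r * q ^ r) ^ 2) := by
          refine Real.sqrt_le_sqrt ?_
          have := Nat.floor_le (a := (4 * q ^ 2) ^ r) (by positivity)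
          have h : (4 * q ^ 2) ^ r = (2 ^ r * q ^ r) ^ 2 := by
            rw [mul_pow, mul_pow, ← pow_mul, ← pow_mul, ← pow_mul, mul_comm r 2, pow_mul 2 2 r]
            norm_num
          rw [h] at this ⊢
          linarith
      _ = √2 * q ^ r * 2 ^ r := by
          rw [Real.sqrt_mul (by norm_num), Real.sqrt_sq (by positivity)]
          ring
  have hup : ∀ r : ℕ, iidMeasure stepLaw {x | ⌊(4 / q ^ 2) ^ r⌋₊ < levelTime x (2 ^ r)} ≤
      ENNReal.ofReal (4 * q ^ r) := fun r => by
    rw [← ofReal_measureReal]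
    have hfp : 0 < ⌊(4 / q ^ 2) ^ r⌋₊ := Nat.floor_pos.mpr (one_le_pow₀ h4q')
    refine ENNReal.ofReal_le_ofReal ((measureReal_lt_levelTime_le hfp _).trans ?_)
    have hfl : (4 / q ^ 2) ^ r / 2 ≤ (⌊(4 / q ^ 2) ^ r⌋₊ : ℝ) := by
      have h1 := Nat.lt_floor_add_one ((4 / q ^ 2) ^ r)
      have h2 : (1 : ℝ) ≤ (⌊(4 / q ^ 2) ^ r⌋₊ : ℝ) := by exact_mod_cast hfp
      linarith
    push_cast
    calc 2 * 2 ^ r * √(2 / (⌊(4 / q ^ 2) ^ r⌋₊ : ℝ)) ≤ 2 * 2 ^ r * √((2 * (q ^ r / 2 ^ r)) ^ 2) := by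
          gcongr
          have h : (2 * (q ^ r / 2 ^ r)) ^ 2 = 2 / ((4 / q ^ 2) ^ r / 2) := by
            rw [div_pow, mul_pow, div_pow, ← pow_mul, ← pow_mul, ← pow_mul, mul_comm r 2,
              pow_mul 2 2 r]
            field_simp
            norm_num
          rw [h]
          gcongr
      _ = 4 * q ^ r := by
          rw [Real.sqrt_sq (by positivity)]
          field_simp
          norm_num
  have hs1 := ne_top_of_le_ne_top (hgeo.mul_left (3 * √2)).tsum_ofReal_lt_top.ne
    (ENNReal.tsum_le_tsum hlow)
  have hs2 := ne_top_of_le_ne_top (hgeo.mul_left 4).tsum_ofReal_lt_top.ne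
    (ENNReal.tsum_le_tsum hup)
  filter_upwards [ae_eventually_notMem hs1, ae_eventually_notMem hs2] with x h1 h2
  filter_upwards [h1, h2] with r hr1 hr2
  simp only [not_le, not_lt] at hr1 hr2
  exact ⟨((Nat.floor_lt (by positivity)).mp hr1).le,
    (Nat.le_floor_iff (by positivity)).mp hr2⟩

theorem ae_eventually_log_levelTime {δ : ℝ} (hδ : 0 < δ) (hδ1 : δ ≤ 1) :
    ∀ᵐ x ∂iidMeasure stepLaw, ∀ᶠ m : ℕ in atTop,
      (2 - δ) * Real.log m ≤ Real.log (levelTime x m) ∧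
        Real.log (levelTime x m) ≤ (2 + δ) * Real.log m := by
  have hl2 : 0 < Real.log 2 := Real.log_pos one_lt_two
  -- With q = exp (-s) the two growth rates have logarithms (2 ∓ δ / 2) log 2. The other δ / 2 pays
  -- for passing from powers of 2 to all m.
  set s := δ / 4 * Real.log 2 with hs
  have hs0 : 0 < s := by positivity
  set q := Real.exp (-s) with hq
  have hq1 : q < 1 := by rw [hq, Real.exp_lt_one_iff]; linarith
  have hq2 : 1 / 2 ≤ q := by
    have : (1 : ℝ) / 2 = Real.exp (-Real.log 2) := by
      rw [Real.exp_neg, Real.exp_log two_pos, one_div]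
    rw [this, hq, Real.exp_le_exp]
    nlinarith
  have hq0 : 0 < q := Real.exp_pos _
  have hlog4 : Real.log 4 = 2 * Real.log 2 := by
    rw [show (4 : ℝ) = 2 ^ 2 by norm_num, Real.log_pow]; norm_num
  have hlogq : Real.log (q ^ 2) = -(2 * s) := by
    rw [Real.log_pow, hq, Real.log_exp]; push_cast; ring
  have hlog1 : Real.log (4 * q ^ 2) = (2 - δ / 2) * Real.log 2 := by
    rw [Real.log_mul (by norm_num) (by positivity), hlog4, hlogq, hs]; ring
  have hlog2 : Real.log (4 / q ^ 2) = (2 + δ / 2) * Real.log 2 := by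
    rw [Real.log_div (by norm_num) (by positivity), hlog4, hlogq, hs]; ring
  have hlogt : Tendsto (fun m : ℕ => Real.log m) atTop atTop :=
    Real.tendsto_log_atTop.comp tendsto_natCast_atTop_atTop
  have hnlog : Tendsto (fun m : ℕ => Nat.log 2 m) atTop atTop :=
    tendsto_atTop_atTop.mpr fun b => ⟨2 ^ b, fun a ha => Nat.le_log_of_pow_le one_lt_two ha⟩
  filter_upwards [ae_eventually_levelTime_two_pow hq2 hq1] with x hx
  filter_upwards [hnlog.eventually hx, hnlog.eventually ((tendsto_add_atTop_nat 1).eventually hx),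
    hlogt.eventually_ge_atTop (6 * Real.log 2 / δ), eventually_gt_atTop 0] with m h1 h2 h3 h4
  set r := Nat.log 2 m with hr
  rw [div_le_iff₀ hδ] at h3
  have hm0 : (0 : ℝ) < m := by exact_mod_cast h4
  have hle : 2 ^ r ≤ m := Nat.pow_log_le_self 2 h4.ne'
  have hlt : m < 2 ^ (r + 1) := Nat.lt_pow_succ_log_self one_lt_two m
  have hlr : r * Real.log 2 ≤ Real.log m := by
    rw [← Real.log_pow]
    exact Real.log_le_log (by positivity) (by exact_mod_cast hle)
  have hlr' : Real.log m ≤ (r + 1) * Real.log 2 := by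
    have := Real.log_le_log hm0 (show (m : ℝ) ≤ 2 ^ (r + 1) by exact_mod_cast hlt.le)
    rw [Real.log_pow] at this
    exact_mod_cast this
  have hT1 : (levelTime x (2 ^ r) : ℝ) ≤ levelTime x m := by exact_mod_cast levelTime_mono x hle
  have hT2 : (levelTime x m : ℝ) ≤ levelTime x (2 ^ (r + 1)) := by
    exact_mod_cast levelTime_mono x hlt.le
  have hpos : (0 : ℝ) < (4 * q ^ 2) ^ r := by positivity
  have hT0 : (0 : ℝ) < levelTime x m := hpos.trans_le (h1.1.trans hT1)
  have h5 := Real.log_le_log hpos (h1.1.trans hT1)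
  have h6 := Real.log_le_log hT0 (hT2.trans h2.2)
  rw [Real.log_pow, hlog1] at h5
  rw [Real.log_pow, hlog2] at h6
  push_cast at h6
  constructor
  · nlinarith
  · nlinarith

/-! ### Sites visited once and cuts, for a fixed path -/

section Path

variable {x : ℕ → ℤ}

theorem walk_levelTime_add (x : ℕ → ℤ) (m j : ℕ) :
    walk x (levelTime x m + j) = walk x (levelTime x m) + walk (passageShift^[m] x) j := by
  rw [walk_add, iterate_passageShift]

theorem walk_levelTime (hx : ∀ m, ∃ n, IsPassage (passageShift^[m] x) n) (m : ℕ) :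
    walk x (levelTime x m) = m := by
  induction m with
  | zero => simp [levelTime]
  | succ m ih =>
    rw [levelTime_succ, walk_levelTime_add, ih, (isPassage_passageTime (hx m)).1]
    push_cast
    rfl

theorem levelTime_lt_succ (hx : ∀ m, ∃ n, IsPassage (passageShift^[m] x) n) (m : ℕ) :
    levelTime x m < levelTime x (m + 1) := by
  rw [levelTime_succ]
  exact Nat.lt_add_of_pos_right (isPassage_passageTime (hx m)).pos

theorem levelTime_strictMono (hx : ∀ m, ∃ n, IsPassage (passageShift^[m] x) n) :
    StrictMono (levelTime x) := strictMono_nat_of_lt_succ (levelTime_lt_succ hx)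

theorem walk_lt_of_lt_levelTime (hx : ∀ m, ∃ n, IsPassage (passageShift^[m] x) n) {m j : ℕ}
    (hj : j < levelTime x m) : walk x j < m := by
  induction m with
  | zero => simp [levelTime] at hj
  | succ m ih =>
    rcases lt_or_ge j (levelTime x m) with h | h
    · have := ih h
      push_cast
      omega
    · obtain ⟨k, rfl⟩ := Nat.exists_eq_add_of_le h
      rw [levelTime_succ] at hj
      have := (isPassage_passageTime (hx m)).2 k (by omega)
      rw [walk_levelTime_add, walk_levelTime hx]
      push_cast
      omega

theorem depthSeq_lt_iff (hx : ∀ m, ∃ n, IsPassage (passageShift^[m] x) n) {t c : ℕ} (hc : 0 < c) :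
    depthSeq x t < c ↔
      ∀ j, levelTime x t ≤ j → j ≤ levelTime x (t + 1) → (t : ℤ) - c < walk x j := by
  rw [depthSeq, passageDepth_lt_iff hc]
  constructor
  · intro h j hj hj'
    obtain ⟨k, rfl⟩ := Nat.exists_eq_add_of_le hj
    rw [levelTime_succ] at hj'
    have := h k (by omega)
    rw [walk_levelTime_add, walk_levelTime hx]
    omega
  · intro h k hk
    have := h (levelTime x t + k) (by omega) (by rw [levelTime_succ]; omega)
    rw [walk_levelTime_add, walk_levelTime hx] at this
    omega

theorem localTime_eq_one_iff (y : ℕ → ℤ) (s : ℤ) (n : ℕ) :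
    localTime y s n = 1 ↔ ∃ j ≤ n, y j = s ∧ ∀ i ≤ n, y i = s → i = j := by
  rw [localTime, Finset.card_eq_one]
  constructor
  · rintro ⟨j, hj⟩
    have h1 : j ∈ (Finset.range (n + 1)).filter (fun j => y j = s) := by simp [hj]
    rw [Finset.mem_filter, Finset.mem_range] at h1
    refine ⟨j, by omega, h1.2, fun i hi his => ?_⟩
    have h2 : i ∈ (Finset.range (n + 1)).filter (fun j => y j = s) := by
      rw [Finset.mem_filter, Finset.mem_range]
      exact ⟨by omega, his⟩
    rwa [hj, Finset.mem_singleton] at h2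
  · rintro ⟨j, hj, hjs, h⟩
    refine ⟨j, ?_⟩
    ext i
    rw [Finset.mem_filter, Finset.mem_range, Finset.mem_singleton]
    constructor
    · rintro ⟨hi, his⟩
      exact h i (by omega) his
    · rintro rfl
      exact ⟨by omega, hjs⟩

theorem exists_walk_eq (hx : IsNearestNeighbour x) {s : ℤ} {a b : ℕ} (hab : a ≤ b)
    (ha : walk x a ≤ s) (hb : s ≤ walk x b) : ∃ j, a ≤ j ∧ j ≤ b ∧ walk x j = s := by
  induction b, hab using Nat.le_induction with
  | base => exact ⟨a, le_rfl, le_rfl, le_antisymm ha hb⟩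
  | succ b hab ih =>
    rcases le_or_gt s (walk x b) with h | h
    · obtain ⟨j, h1, h2, h3⟩ := ih h
      exact ⟨j, h1, h2.trans (Nat.le_succ b), h3⟩
    · refine ⟨b + 1, by omega, le_rfl, ?_⟩
      rw [walk_succ] at hb ⊢
      have := hx b
      omega

theorem exists_levelTime_le {t m j : ℕ}
    (htj : levelTime x t ≤ j) (hj : j ≤ levelTime x m) (htm : t < m) :
    ∃ u, t ≤ u ∧ u < m ∧ levelTime x u ≤ j ∧ j ≤ levelTime x (u + 1) := by
  induction m, htm using Nat.le_induction with
  | base => exact ⟨t, le_rfl, Nat.lt_succ_self t, htj, hj⟩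
  | succ m htm ih =>
    rcases le_or_gt j (levelTime x m) with h | h
    · obtain ⟨u, h1, h2, h3⟩ := ih h
      exact ⟨u, h1, h2.trans (Nat.lt_succ_self m), h3⟩
    · exact ⟨m, by omega, Nat.lt_succ_self m, h.le, hj⟩

theorem localTime_eq_one_of_isCut (hnn : IsNearestNeighbour x)
    (hx : ∀ m, ∃ n, IsPassage (passageShift^[m] x) n)
    {s m : ℕ} (hsm : s < m) (h : IsCut (depthSeq x) s m) :
    localTime (walk x) s (levelTime x m) = 1 := by
  rw [localTime_eq_one_iff]
  refine ⟨levelTime x s, levelTime_mono x hsm.le, walk_levelTime hx s, fun i hi his => ?_⟩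
  by_contra hne
  rcases lt_or_gt_of_ne hne with hlt | hgt
  · have := walk_lt_of_lt_levelTime hx hlt
    omega
  · obtain ⟨u, hsu, hum, h1, h2⟩ := exists_levelTime_le hgt.le hi hsm
    obtain ⟨k, rfl⟩ := Nat.exists_eq_add_of_le hsu
    have hk := h k hum
    -- Right after `s` is reached, depth 0 excludes a step down, so the walk goes straight to s + 1.
    -- At higher levels the depth bound itself keeps the walk above `s`.
    rcases Nat.eq_zero_or_pos k with rfl | hk0
    · rw [add_zero] at h1 h2 hk
      have hk' := (depthSeq_lt_iff hx one_pos).mp hk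
      have hy : IsNearestNeighbour (passageShift^[s] x) := by
        rw [iterate_passageShift]
        exact hnn.seqShift _
      rcases hy 0 with h0 | h0
      · rw [levelTime_succ, (isPassage_one h0).passageTime_eq] at h2
        have h3 : i = levelTime x s + 1 := by omega
        rw [h3, walk_levelTime_add, walk_levelTime hx, (isPassage_one h0).1] at his
        omega
      · have h3 := hk' (levelTime x s + 1) (by omega) (levelTime_lt_succ hx s)
        have h4 := walk_one_add h0 0
        simp only [add_zero, walk_zero] at h4
        rw [walk_levelTime_add, walk_levelTime hx, h4] at h3
        push_cast at h3
        omega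
    · have hk' := (depthSeq_lt_iff hx (c := k) hk0).mp (by omega) i h1 h2
      push_cast at hk'
      omega

theorem cutCount_le_numOnceVisited (hnn : IsNearestNeighbour x)
    (hx : ∀ m, ∃ n, IsPassage (passageShift^[m] x) n) (m : ℕ) :
    cutCount (depthSeq x) 0 m ≤ numOnceVisited (walk x) (levelTime x m) := by
  classical
  rw [numOnceVisited, cutCount, ← Finset.card_image_of_injective _ (Nat.cast_injective (R := ℤ)),
    ← Set.ncard_coe_finset]
  refine Set.ncard_le_ncard ?_ (finite_onceVisited _ _)
  intro s hs
  simp only [Finset.coe_image, Set.mem_image, Finset.coe_filter, Finset.mem_Ico,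
    Set.mem_ofPred_eq] at hs
  obtain ⟨t, ⟨⟨_, ht⟩, hc⟩, rfl⟩ := hs
  exact localTime_eq_one_of_isCut hnn hx ht hc

/-- If a depth were too large, the walk would be at or below `s` again after its first visit, and it
would have to cross `s` once more on its way up to `m`. -/
theorem isCut_of_localTime_eq_one (hnn : IsNearestNeighbour x)
    (hx : ∀ m, ∃ n, IsPassage (passageShift^[m] x) n) {s m n : ℕ} (hsm : s < m)
    (hn : levelTime x m ≤ n) (h : localTime (walk x) s n = 1) : IsCut (depthSeq x) s m := by
  intro i hi
  rw [localTime_eq_one_iff] at h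
  obtain ⟨j, hj, hjs, huniq⟩ := h
  have hsj : levelTime x s = j :=
    huniq _ ((levelTime_mono x hsm.le).trans hn) (walk_levelTime hx s)
  rw [depthSeq_lt_iff hx (by omega)]
  intro k hk1 hk2
  by_contra hcon
  have hki : walk x k ≤ s - 1 ∨ walk x k ≤ s ∧ 0 < i := by
    push_cast at hcon
    omega
  have hk3 : k ≤ levelTime x m := hk2.trans (levelTime_mono x (by omega))
  have hsk : levelTime x s < k := by
    rcases hki with h1 | ⟨h1, h2⟩
    · refine lt_of_le_of_ne ((levelTime_mono x (by omega)).trans hk1) fun he => ?_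
      rw [← he, walk_levelTime hx] at h1
      omega
    · exact (levelTime_strictMono hx (by omega)).trans_le hk1
  obtain ⟨l, hl1, hl2, hl3⟩ := exists_walk_eq hnn (s := s) hk3
    (by rcases hki with h1 | ⟨h1, _⟩ <;> omega) (by rw [walk_levelTime hx]; omega)
  have := huniq l (hl2.trans hn) hl3
  omega

theorem exists_levelTime_le_lt (hx : ∀ m, ∃ n, IsPassage (passageShift^[m] x) n) (n : ℕ) :
    ∃ m, levelTime x m ≤ n ∧ n < levelTime x (m + 1) := by
  classical
  have hex : ∃ m, n < levelTime x m :=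
    ⟨n + 1, Nat.lt_of_succ_le ((levelTime_strictMono hx).id_le (n + 1))⟩
  have h0 : Nat.find hex ≠ 0 := fun h => by
    have := Nat.find_spec hex
    rw [h] at this
    simp [levelTime] at this
  obtain ⟨m, hm⟩ := Nat.exists_eq_succ_of_ne_zero h0
  refine ⟨m, not_lt.mp (Nat.find_min hex (by omega)), ?_⟩
  rw [← Nat.succ_eq_add_one, ← hm]
  exact Nat.find_spec hex

/-- Apart from cuts below `m`, only two sites can count: `m` itself, above which the walk has not
been, and the minimum of the path. Any other negative site that was visited is crossed on the way
down to the minimum and again on the way back to a nonnegative position. -/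
theorem numOnceVisited_le_cutCount (hnn : IsNearestNeighbour x)
    (hx : ∀ m, ∃ n, IsPassage (passageShift^[m] x) n) {m n : ℕ} (hmn : levelTime x m ≤ n)
    (hnm : n < levelTime x (m + 1)) (hpos : 0 ≤ walk x n) :
    numOnceVisited (walk x) n ≤ cutCount (depthSeq x) 0 m + 2 := by
  classical
  obtain ⟨a, han, ha⟩ := Finset.exists_min_image (Finset.range (n + 1)) (walk x) ⟨0, by simp⟩
  set A : Finset ℤ := insert (m : ℤ) (insert (walk x a)
    (((Finset.Ico 0 m).filter fun s => IsCut (depthSeq x) s m).image Nat.cast)) with hA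
  have hsub : onceVisited (walk x) n ⊆ A := by
    intro s hs
    have hs' : localTime (walk x) s n = 1 := hs
    have hs1 := hs'
    rw [localTime_eq_one_iff] at hs1
    obtain ⟨j, hj, hjs, huniq⟩ := hs1
    rw [hA, Finset.mem_coe, Finset.mem_insert, Finset.mem_insert, Finset.mem_image]
    rcases lt_or_ge s 0 with hneg | hnneg
    · right; left
      by_contra hne
      have haj := ha j (Finset.mem_range.mpr (by omega))
      have hlt : walk x a < s := by omega
      have han' : a ≤ n := by have := Finset.mem_range.mp han; omega
      obtain ⟨l, hl1, hl2, hl3⟩ := exists_walk_eq hnn han' hlt.le (by omega : s ≤ walk x n)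
      have hjl := huniq l hl2 hl3
      have hneg' : IsNearestNeighbour fun i => -x i := fun i => by
        have := hnn i
        dsimp only
        omega
      have hw : ∀ k, walk (fun i => -x i) k = -walk x k := fun k => by simp [walk]
      obtain ⟨l', _, hl2', hl3'⟩ := exists_walk_eq hneg' (s := -s) (Nat.zero_le a)
        (by rw [hw, walk_zero]; omega) (by rw [hw]; omega)
      rw [hw] at hl3'
      have hjl' := huniq l' (hl2'.trans han') (by omega)
      have hla : a = l := by omega
      rw [← hla] at hl3
      omega
    · have hsm : s ≤ m := by
        have := walk_lt_of_lt_levelTime hx (lt_of_le_of_lt hj hnm)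
        push_cast at this
        omega
      rcases hsm.lt_or_eq with hlt | heq
      · right; right
        obtain ⟨t, rfl⟩ := Int.eq_ofNat_of_zero_le hnneg
        have htm : t < m := by omega
        refine ⟨t, ?_, rfl⟩
        rw [Finset.mem_filter, Finset.mem_Ico]
        exact ⟨⟨Nat.zero_le _, htm⟩, isCut_of_localTime_eq_one hnn hx htm hmn hs'⟩
      · exact Or.inl heq
  rw [numOnceVisited]
  refine (Set.ncard_le_ncard hsub A.finite_toSet).trans ?_
  rw [Set.ncard_coe_finset]
  refine (Finset.card_insert_le _ _).trans (Nat.add_le_add_right ?_ 1)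
  exact (Finset.card_insert_le _ _).trans (Nat.add_le_add_right Finset.card_image_le 1)

end Path

/-! ### From depths and levels back to the walk and its time -/

theorem ae_forall_exists_isPassage :
    ∀ᵐ x ∂iidMeasure stepLaw, ∀ m, ∃ n, IsPassage (passageShift^[m] x) n :=
  ae_all_iff.mpr fun m =>
    (measurePreserving_passageShift.iterate m).quasiMeasurePreserving.ae ae_exists_isPassage

theorem ae_depthSeq {p : (ℕ → ℕ) → Prop} (h : ∀ᵐ d ∂iidMeasure depthLaw, p d) :
    ∀ᵐ x ∂iidMeasure stepLaw, p (depthSeq x) := by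
  rw [← map_depthSeq] at h
  exact ae_of_ae_map measurable_depthSeq.aemeasurable h

theorem tendsto_log_natCast : Tendsto (fun n : ℕ => Real.log n) atTop atTop :=
  Real.tendsto_log_atTop.comp tendsto_natCast_atTop_atTop

theorem ae_eventually_numOnceVisited_walk_le {ε : ℝ} (hε : 0 < ε) :
    ∀ᵐ x ∂iidMeasure stepLaw, ∀ᶠ n : ℕ in atTop, 0 ≤ walk x n →
      (numOnceVisited (walk x) n : ℝ) ≤ (1 / 16 + ε) * Real.log n ^ 2 := by
  -- Chosen so that (1/4 + δ) / (2 - δ)² ≤ 1/16 + ε / 2; the remaining ε / 2 absorbs the two extra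
  -- sites.
  set δ := ε / (1 + ε) with hδ
  have hδ0 : 0 < δ := by positivity
  have hδ1 : δ ≤ 1 := by rw [hδ, div_le_one (by positivity)]; linarith
  have hδε : 1 / 4 + δ ≤ (1 / 16 + ε / 2) * (2 - δ) ^ 2 := by
    have h1 : δ * (1 + ε) = ε := by rw [hδ]; field_simp
    have h2 : δ * (5 / 4 + 2 * ε) ≤ 2 * ε := by nlinarith
    have h3 : 4 - 4 * δ ≤ (2 - δ) ^ 2 := by nlinarith
    have h4 : (1 / 16 + ε / 2) * (4 - 4 * δ) ≤ (1 / 16 + ε / 2) * (2 - δ) ^ 2 := by gcongr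
    nlinarith
  filter_upwards [ae_isNearestNeighbour, ae_forall_exists_isPassage,
    ae_depthSeq (isDepthLaw_depthLaw.ae_eventually_cutCount_le hδ0),
    ae_eventually_log_levelTime hδ0 hδ1] with x hnn hx hcut hlevel
  obtain ⟨M, hM⟩ := eventually_atTop.mp (hcut.and hlevel)
  filter_upwards [eventually_ge_atTop (levelTime x (M + 1)), eventually_gt_atTop 0,
    tendsto_log_natCast.eventually_ge_atTop (max 1 (4 / ε))] with n hn hn0 hlog hpos
  obtain ⟨m, hm1, hm2⟩ := exists_levelTime_le_lt hx n
  have hMm : M ≤ m := by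
    have := (levelTime_strictMono hx).lt_iff_lt.mp (hn.trans_lt hm2)
    omega
  obtain ⟨h1, h2, -⟩ := hM m hMm
  have h3 : (numOnceVisited (walk x) n : ℝ) ≤ cutCount (depthSeq x) 0 m + 2 := by
    exact_mod_cast numOnceVisited_le_cutCount hnn hx hm1 hm2 hpos
  have hl1 : 1 ≤ Real.log n := (le_max_left _ _).trans hlog
  have hl2 : 4 ≤ ε * Real.log n := by
    have := (le_max_right _ _).trans hlog
    rwa [div_le_iff₀' hε] at this
  have hlm : 0 ≤ Real.log m := Real.log_natCast_nonneg m
  have h4 : (2 - δ) * Real.log m ≤ Real.log n := by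
    refine h2.trans ?_
    rcases Nat.eq_zero_or_pos (levelTime x m) with h0 | h0
    · rw [h0, Nat.cast_zero, Real.log_zero]
      linarith
    · exact Real.log_le_log (by exact_mod_cast h0) (by exact_mod_cast hm1)
  have h5 : ((2 - δ) * Real.log m) ^ 2 ≤ Real.log n ^ 2 := by
    have : 0 ≤ (2 - δ) * Real.log m := mul_nonneg (by linarith) hlm
    gcongr
  have h6 : (1 / 4 + δ) * Real.log m ^ 2 ≤ (1 / 16 + ε / 2) * Real.log n ^ 2 := by
    calc (1 / 4 + δ) * Real.log m ^ 2 ≤ (1 / 16 + ε / 2) * (2 - δ) ^ 2 * Real.log m ^ 2 := by gcongr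
      _ = (1 / 16 + ε / 2) * ((2 - δ) * Real.log m) ^ 2 := by ring
      _ ≤ _ := by gcongr
  nlinarith

theorem ae_frequently_le_numOnceVisited_walk {ε : ℝ} (hε : 0 < ε) (hε1 : ε ≤ 1 / 16) :
    ∀ᵐ x ∂iidMeasure stepLaw, ∃ᶠ n : ℕ in atTop,
      (1 / 16 - ε) * Real.log n ^ 2 ≤ (numOnceVisited (walk x) n : ℝ) := by
  have hεε : (1 / 16 - ε) * (2 + ε) ^ 2 ≤ 1 / 4 - ε := by nlinarith [sq_nonneg ε, pow_pos hε 3]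
  filter_upwards [ae_isNearestNeighbour, ae_forall_exists_isPassage,
    ae_depthSeq (isDepthLaw_depthLaw.ae_frequently_le_cutCount hε (by linarith)),
    ae_eventually_log_levelTime hε (by linarith)] with x hnn hx hcut hlevel
  refine (levelTime_strictMono hx).tendsto_atTop.frequently
    ((hcut.and_eventually hlevel).mono fun m hm => ?_)
  obtain ⟨h1, -, h2⟩ := hm
  have h3 : (cutCount (depthSeq x) 0 m : ℝ) ≤ numOnceVisited (walk x) (levelTime x m) := by
    exact_mod_cast cutCount_le_numOnceVisited hnn hx m
  refine le_trans ?_ (h1.trans h3)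
  have h4 : 0 ≤ Real.log (levelTime x m) := Real.log_natCast_nonneg _
  have h5 : 0 ≤ 1 / 16 - ε := by linarith
  calc (1 / 16 - ε) * Real.log (levelTime x m) ^ 2
      ≤ (1 / 16 - ε) * ((2 + ε) * Real.log m) ^ 2 := by gcongr
    _ = (1 / 16 - ε) * (2 + ε) ^ 2 * Real.log m ^ 2 := by ring
    _ ≤ _ := by gcongr

/-! ### An arbitrary simple random walk -/

section SimpleRandomWalk

variable {Ω : Type*} [MeasurableSpace Ω] {μ : Measure Ω} {S : ℕ → Ω → ℤ}

theorem IsSimpleRandomWalk.map_increment [IsProbabilityMeasure μ]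
    (hS : IsSimpleRandomWalk μ S) (n : ℕ) :
    μ.map (fun ω => S (n + 1) ω - S n ω) = stepLaw := by
  have hm : Measurable fun ω => S (n + 1) ω - S n ω := (hS.measurable _).sub (hS.measurable _)
  refine Measure.ext_of_singleton fun a => ?_
  rw [Measure.map_apply hm (measurableSet_singleton a), stepLaw_apply]
  have hset : (fun ω => S (n + 1) ω - S n ω) ⁻¹' {a} = {ω | S (n + 1) ω - S n ω = a} := rfl
  rw [hset]
  by_cases h1 : a = 1
  · subst h1; simpa using hS.step_up n
  by_cases h2 : a = -1
  · subst h2; simpa using hS.step_down n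
  have h0 : μ ({ω | S (n + 1) ω - S n ω = 1} ∪ {ω | S (n + 1) ω - S n ω = -1})ᶜ = 0 := by
    have hms : ∀ b : ℤ, MeasurableSet {ω | S (n + 1) ω - S n ω = b} := fun b =>
      hm (measurableSet_singleton b)
    rw [prob_compl_eq_zero_iff ((hms 1).union (hms (-1))), measure_union _ (hms (-1)),
      hS.step_up, hS.step_down, ENNReal.add_halves]
    refine Set.disjoint_left.mpr fun ω (hω : _ = _) (hω' : _ = _) => ?_
    omega
  have h3 : μ {ω | S (n + 1) ω - S n ω = a} = 0 := by
    refine measure_mono_null (fun ω (hω : _ = a) => ?_) h0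
    rintro (h | h)
    · exact h1 (hω.symm.trans h)
    · exact h2 (hω.symm.trans h)
  rw [h3]
  simp [Ne.symm h1, Ne.symm h2]

theorem IsSimpleRandomWalk.ae_of_ae_walk [IsProbabilityMeasure μ]
    (hS : IsSimpleRandomWalk μ S) {p : (ℕ → ℤ) → Prop}
    (h : ∀ᵐ x ∂iidMeasure stepLaw, p (walk x)) : ∀ᵐ ω ∂μ, p fun n => S n ω := by
  have hm : ∀ n, Measurable fun ω => S (n + 1) ω - S n ω := fun n =>
    (hS.measurable _).sub (hS.measurable _)
  have hmap : μ.map (fun ω n => S (n + 1) ω - S n ω) = iidMeasure stepLaw := by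
    rw [(iIndepFun_iff_map_fun_eq_infinitePi_map hm).mp hS.indep]
    simp only [hS.map_increment]
  rw [← hmap] at h
  filter_upwards [ae_of_ae_map (measurable_pi_lambda _ hm).aemeasurable h, hS.start] with ω hω h0
  have : walk (fun n => S (n + 1) ω - S n ω) = fun n => S n ω := by
    funext n
    rw [walk, Finset.sum_range_sub (fun n => S n ω), h0, sub_zero]
  rwa [this] at hω

theorem IsSimpleRandomWalk.neg (hS : IsSimpleRandomWalk μ S) :
    IsSimpleRandomWalk μ fun n ω => -S n ω where
  measurable n := (hS.measurable n).neg
  start := by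
    filter_upwards [hS.start] with ω h
    rw [h, neg_zero]
  indep := by
    have := hS.indep.comp (fun _ a => -a) fun _ => measurable_neg
    convert this using 2 with n
    funext ω
    simp only [Function.comp_apply]
    ring
  step_up n := by
    rw [← hS.step_down n]
    congr 1
    ext ω
    simp only [Set.mem_ofPred_eq]
    omega
  step_down n := by
    rw [← hS.step_up n]
    congr 1
    ext ω
    simp only [Set.mem_ofPred_eq]
    omega

theorem numOnceVisited_neg (x : ℕ → ℤ) (n : ℕ) :
    numOnceVisited (fun j => -x j) n = numOnceVisited x n := by
  have h : onceVisited (fun j => -x j) n = Neg.neg '' onceVisited x n := by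
    ext s
    have hl : localTime (fun j => -x j) s n = localTime x (-s) n := by
      simp only [localTime, neg_eq_iff_eq_neg]
    simp only [onceVisited, Set.mem_ofPred_eq, Set.mem_image, hl]
    exact ⟨fun hs => ⟨-s, hs, neg_neg s⟩, fun ⟨t, ht, hts⟩ => by rw [← hts, neg_neg]; exact ht⟩
  rw [numOnceVisited, h, Set.ncard_image_of_injective _ neg_injective]
  rfl

/-- The bound is known at times when the walk is nonnegative. The reflected walk has the same law
and the same count, and covers the remaining times. -/
theorem IsSimpleRandomWalk.ae_eventually_numOnceVisited_le [IsProbabilityMeasure μ]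
    (hS : IsSimpleRandomWalk μ S) {ε : ℝ} (hε : 0 < ε) : ∀ᵐ ω ∂μ, ∀ᶠ n : ℕ in atTop,
      (numOnceVisited (fun j => S j ω) n : ℝ) ≤ (1 / 16 + ε) * Real.log n ^ 2 := by
  have h := ae_eventually_numOnceVisited_walk_le hε
  filter_upwards [hS.ae_of_ae_walk (p := fun y => ∀ᶠ n : ℕ in atTop, 0 ≤ y n →
      (numOnceVisited y n : ℝ) ≤ (1 / 16 + ε) * Real.log n ^ 2) h,
    hS.neg.ae_of_ae_walk (p := fun y => ∀ᶠ n : ℕ in atTop, 0 ≤ y n →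
      (numOnceVisited y n : ℝ) ≤ (1 / 16 + ε) * Real.log n ^ 2) h] with ω h1 h2
  filter_upwards [h1, h2] with n h1 h2
  rw [numOnceVisited_neg] at h2
  rcases le_total 0 (S n ω) with h | h
  · exact h1 h
  · exact h2 (by omega)

end SimpleRandomWalk

/-- Countably many tolerances suffice, so that they can be combined almost surely; the offset `k₀`
allows lower bounds that are known only for small tolerances. -/
theorem limsup_coe_div_log_sq_eq {u : ℕ → ℝ} {c : ℝ} {k₀ : ℕ}
    (hup : ∀ k : ℕ, ∀ᶠ n : ℕ in atTop, u n ≤ (c + 1 / ((k : ℝ) + k₀ + 1)) * Real.log n ^ 2)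
    (hlow : ∀ k : ℕ, ∃ᶠ n : ℕ in atTop, (c - 1 / ((k : ℝ) + k₀ + 1)) * Real.log n ^ 2 ≤ u n) :
    limsup (fun n : ℕ => ((u n / Real.log n ^ 2 : ℝ) : EReal)) atTop = (c : EReal) := by
  have hlog : ∀ᶠ n : ℕ in atTop, 0 < Real.log n := tendsto_log_natCast.eventually_gt_atTop 0
  have hk : ∀ δ : ℝ, 0 < δ → ∃ k : ℕ, 1 / ((k : ℝ) + k₀ + 1) ≤ δ := fun δ hδ => by
    obtain ⟨k, hk⟩ := exists_nat_one_div_lt hδ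
    refine ⟨k, le_trans ?_ hk.le⟩
    have : (0 : ℝ) ≤ k₀ := Nat.cast_nonneg _
    gcongr
    linarith
  refine le_antisymm ?_ ?_
  · refine EReal.le_of_forall_lt_iff_le.mp fun z hz => ?_
    have hz' : c < z := EReal.coe_lt_coe_iff.mp hz
    obtain ⟨k, hk⟩ := hk (z - c) (by linarith)
    refine limsup_le_of_le (by isBoundedDefault) ?_
    filter_upwards [hup k, hlog] with n hn hl
    rw [EReal.coe_le_coe_iff, div_le_iff₀ (by positivity)]
    refine hn.trans ?_
    gcongr
    linarith
  · refine EReal.ge_of_forall_gt_iff_ge.mp fun z hz => ?_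
    have hz' : z < c := EReal.coe_lt_coe_iff.mp hz
    obtain ⟨k, hk⟩ := hk (c - z) (by linarith)
    refine le_limsup_of_frequently_le ?_ (by isBoundedDefault)
    refine ((hlow k).and_eventually hlog).mono fun n hn => ?_
    obtain ⟨hn, hl⟩ := hn
    rw [EReal.coe_le_coe_iff, le_div_iff₀ (by positivity)]
    refine le_trans ?_ hn
    gcongr
    linarith

theorem theorem1 {Ω : Type*} [MeasurableSpace Ω] (μ : Measure Ω) [IsProbabilityMeasure μ]
    (S : ℕ → Ω → ℤ) (hS : IsSimpleRandomWalk μ S) :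
    ∀ᵐ ω ∂μ,
      limsup (fun n : ℕ =>
        (((numOnceVisited (fun j => S j ω) n : ℝ) / (Real.log n) ^ 2 : ℝ) : EReal)) atTop
        = ((1 / 16 : ℝ) : EReal) := by
  -- The offset 15 makes every tolerance at most 1/16, as the lower bound requires.
  have hup := ae_all_iff.mpr fun k : ℕ =>
    hS.ae_eventually_numOnceVisited_le (ε := 1 / ((k : ℝ) + (15 : ℕ) + 1)) (by positivity)
  have hlow := ae_all_iff.mpr fun k : ℕ =>
    hS.ae_of_ae_walk (p := fun y => ∃ᶠ n : ℕ in atTop,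
      (1 / 16 - 1 / ((k : ℝ) + (15 : ℕ) + 1)) * Real.log n ^ 2 ≤ (numOnceVisited y n : ℝ))
      (ae_frequently_le_numOnceVisited_walk (by positivity) (by
        have : (0 : ℝ) ≤ k := Nat.cast_nonneg k
        push_cast
        exact one_div_le_one_div_of_le (by norm_num) (by linarith)))
  filter_upwards [hup, hlow] with ω h1 h2
  exact limsup_coe_div_log_sq_eq h1 h2
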